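/- Let $T\ge 1$, let $\mathcal X=\prod_{t=1}^T\mathcal X_t$ be a product of Polish spaces, and let $d$ be any metric on $\mathcal X$ that metrizes the product topology. Denote by $\mathcal P(\mathcal X)$ the set of Borel probability measures on $\mathcal X$. A coupling $\pi$ of $\mu,\nu\in\mathcal P(\mathcal X)$ is called bicausal if, for $(X,Y)\sim\pi$ and every $t\in\{1,\dots,T-1\}$, under $\pi$ the vector $(Y_1,\dots,Y_t)$ is conditionally independent of $X$ given $(X_1,\dots,X_t)$, and $(X_1,\dots,X_t)$ is conditionally independent of $Y$ given $(Y_1,\dots,Y_t)$. For $1\le p<\infty$ let $$\mathcal{AW}_p(\mu,\nu)=\inf_{\pi}\Big(\int_{\mathcal X\times\mathcal X}d(x,y)^p\,\pi(dx,dy)\Big)^{1/p}\in[0,\infty],$$ where the infimum is over all bicausal couplings $\pi$ of $\mu$ and $\nu$. Let $H(\nu|\mu)=\int_{\mathcal X}\log\frac{d\nu}{d\mu}\,d\nu\in[0,\infty]$ if $\nu\ll\mu$, and $H(\nu|\mu)=+\infty$ otherwise. Let $p>1$ and let $\mu\in\mathcal P(\mathcal X)$, $x_0\in\mathcal X$ and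 $\alpha>0$ be such that $\int_{\mathcal X}e^{\alpha d(x,x_0)^{2p}}\,\mu(dx)<\infty$. Then, for all $\nu\in\mathcal P(\mathcal X)$, $$\mathcal{AW}_p(\mu,\nu)^p\le\frac{2^{p-1}(2\sqrt T+1)}{\sqrt\alpha}\Big(1+\log\int_{\mathcal X}e^{\alpha d(x,x_0)^{2p}}\,\mu(dx)\Big)^{1/2}\sqrt{2H(\nu|\mu)}.$$ -/

import Mathlib

open MeasureTheory ProbabilityTheory InformationTheory
open scoped ENNReal

/-- The path `x` up to time `t`, that is `(x_1, …, x_t)` for a path `x = (x_1, …, x_T)`.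
(Time `s ∈ {1, …, T}` is the index `s - 1 : Fin T`.) -/
def pathUpTo {T : ℕ} {X : Fin T → Type*} (t : ℕ) (x : ∀ i, X i) :
    ∀ i : {i : Fin T // i.val < t}, X i.val :=
  fun i => x i.val

theorem measurable_pathUpTo {T : ℕ} {X : Fin T → Type*} [∀ i, MeasurableSpace (X i)] (t : ℕ) :
    Measurable (pathUpTo (X := X) t) :=
  measurable_pi_lambda _ fun i => measurable_pi_apply i.val

theorem measurable_pathUpTo_fst {T : ℕ} {X : Fin T → Type*} [∀ i, MeasurableSpace (X i)]
    (t : ℕ) : Measurable fun z : (∀ i, X i) × (∀ i, X i) => pathUpTo t z.1 :=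
  (measurable_pathUpTo t).comp measurable_fst

theorem measurable_pathUpTo_snd {T : ℕ} {X : Fin T → Type*} [∀ i, MeasurableSpace (X i)]
    (t : ℕ) : Measurable fun z : (∀ i, X i) × (∀ i, X i) => pathUpTo t z.2 :=
  (measurable_pathUpTo t).comp measurable_snd

/-- `π` is a bicausal coupling of `μ` and `ν`: it has marginals `μ` and `ν`, and, for
`(X, Y) ∼ π` and every `t ∈ {1, …, T - 1}`, under `π` the path `(Y_1, …, Y_t)` is independent of
`X` conditionally on `(X_1, …, X_t)`, and `(X_1, …, X_t)` is independent of `Y` conditionally on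
`(Y_1, …, Y_t)`. -/
structure IsBicausalCoupling {T : ℕ} {X : Fin T → Type*} [∀ i, MeasurableSpace (X i)]
    [∀ i, StandardBorelSpace (X i)] (π : Measure ((∀ i, X i) × (∀ i, X i)))
    [IsFiniteMeasure π] (μ ν : Measure (∀ i, X i)) : Prop where
  map_fst : π.map Prod.fst = μ
  map_snd : π.map Prod.snd = ν
  causal : ∀ t : ℕ, 1 ≤ t → t < T →
    CondIndepFun (MeasurableSpace.comap (fun z => pathUpTo t z.1) inferInstance)
      (measurable_pathUpTo_fst t).comap_le
      (fun z => pathUpTo t z.2) (fun z => z.1) π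
  anticausal : ∀ t : ℕ, 1 ≤ t → t < T →
    CondIndepFun (MeasurableSpace.comap (fun z => pathUpTo t z.2) inferInstance)
      (measurable_pathUpTo_snd t).comap_le
      (fun z => pathUpTo t z.1) (fun z => z.2) π

/-- The `p`-adapted Wasserstein distance between `μ` and `ν` for the metric `d`, with values in
`[0, ∞]`. -/
noncomputable def adaptedWasserstein {T : ℕ} {X : Fin T → Type*} [∀ i, MeasurableSpace (X i)]
    [∀ i, StandardBorelSpace (X i)] (d : (∀ i, X i) → (∀ i, X i) → ℝ) (p : ℝ)
    (μ ν : Measure (∀ i, X i)) : ℝ≥0∞ :=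
  ⨅ (π : ProbabilityMeasure ((∀ i, X i) × (∀ i, X i)))
    (_ : IsBicausalCoupling (π : Measure ((∀ i, X i) × (∀ i, X i))) μ ν),
    (∫⁻ z, ENNReal.ofReal (d z.1 z.2) ^ p ∂(π : Measure ((∀ i, X i) × (∀ i, X i)))) ^ (1 / p)

open scoped NNReal

/-! It suffices to exhibit one bicausal coupling with small cost. If `ν ≪ μ` fails, the right side
is infinite. Otherwise let `M s` be the density of `ν` with respect to `μ` on the first `s`
coordinates, a martingale with ratios `r s = M (s+1) / M s`. Couple the two processes greedily:
while they agree, the conditional laws of the next step are coupled maximally, so the common part up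
to time `s` has density `w s = ∏ i < s, min 1 (r i)`. Once they separate, they run independently
given the common past, one as under `μ` and the other as under `ν`. This is bicausal
(`lintegral_congr_of_causal`, `condIndepFun_of_lintegral_eq`).

The cost vanishes on the diagonal, and elsewhere is at most `2^(p-1) (φ x + φ y)` with `φ = d(·,
x₀)^p`. The separated mass has density `S = 1 - w T` in the first marginal and `M T - w T ≤ S + (M T
- 1)⁺` in the second. Hence the cost is at most `2^(p-1) (2 ∫ φ S dμ + ∫ φ (M T - 1)⁺ dμ)`
(`lintegral_cost_le`).

Both integrals are bounded by Cauchy–Schwarz. For the first, `S` is the sum of `w s (1 - r s)⁺`, and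
`w s ^ 2 ≤ w s ≤ M s`, so `S ^ 2` is controlled by `T` times the sum of the terms `2 M s klFun (r
s)`; by the chain rule for entropy these integrate to at most `2H` in total
(`lintegral_sq_separation_le`). This gives `2√T`. The second is a weighted Pinsker inequality
(`lintegral_mul_tsub_one_sq_le`) and gives the `+ 1`. Exponential integrability enters through the
variational inequality for entropy (`lintegral_mul_le_densityEntropy_add`). -/

theorem measurable_indicator_one_ennreal {Ω : Type*} {m : MeasurableSpace Ω} {s : Set Ω}
    (hs : MeasurableSet s) : Measurable (s.indicator (1 : Ω → ℝ≥0∞)) :=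
  measurable_one.indicator hs

/-! ### Conditional expectation of `[0, ∞]`-valued functions -/

section CondMean

variable {Ω : Type*} {m mΩ : MeasurableSpace Ω} [StandardBorelSpace Ω]

/-- The conditional expectation of a nonnegative function `f` given `m`, as the integral of `f`
against the regular conditional probability. -/
noncomputable def condMean {Ω : Type*} (m : MeasurableSpace Ω) {mΩ : MeasurableSpace Ω}
    [StandardBorelSpace Ω] (μ : Measure Ω) [IsFiniteMeasure μ] (f : Ω → ℝ≥0∞) (z : Ω) : ℝ≥0∞ :=
  ∫⁻ x, f x ∂(condExpKernel μ m z)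

variable {μ : Measure Ω} [IsProbabilityMeasure μ] {f f' g : Ω → ℝ≥0∞}

theorem measurable_condMean (hf : Measurable f) : Measurable[m] (condMean m μ f) :=
  @Measurable.lintegral_kernel Ω Ω m mΩ (condExpKernel μ m) f hf

/-- Composing the restriction of `μ` to `m` with `condExpKernel` gives the image of `μ` under the
diagonal map. Integrating `g q.1 * f q.2` in both ways gives the two sides. -/
theorem lintegral_mul_condMean (hm : m ≤ mΩ) (hg : Measurable[m] g) (hf : Measurable f) :
    ∫⁻ z, g z * condMean m μ f z ∂μ = ∫⁻ z, g z * f z ∂μ := by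
  have hF : Measurable[m.prod mΩ] fun q : Ω × Ω => g q.1 * f q.2 :=
    Measurable.mul (hg.comp (@measurable_fst _ _ m mΩ)) (hf.comp (@measurable_snd _ _ m mΩ))
  have h1 := @Measure.lintegral_compProd Ω Ω m mΩ (μ.trim hm) (condExpKernel μ m) _ _ _ hF
  rw [compProd_trim_condExpKernel hm] at h1
  have hid : @Measurable Ω (Ω × Ω) mΩ (m.prod mΩ) Function.diag :=
    @Measurable.prodMk Ω mΩ Ω Ω m mΩ _ _ (measurable_id'' hm) measurable_id
  rw [@lintegral_map Ω (Ω × Ω) mΩ (m.prod mΩ) μ _ _ hF hid] at h1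
  simp only [Function.diag] at h1
  rw [h1, ← lintegral_trim hm]
  · refine lintegral_congr fun z => ?_
    rw [lintegral_const_mul _ hf]; rfl
  · exact hg.mul (measurable_condMean hf)

theorem condMean_unique (hm : m ≤ mΩ) (hg : Measurable[m] g) (hf : Measurable f)
    (h : ∀ s, MeasurableSet[m] s → ∫⁻ z in s, g z ∂μ = ∫⁻ z in s, f z ∂μ) :
    condMean m μ f =ᵐ[μ] g := by
  have hc : Measurable[m] (condMean m μ f) := measurable_condMean hf
  refine ae_eq_of_ae_eq_trim (hm := hm) ?_
  refine @ae_eq_of_forall_setLIntegral_eq_of_sigmaFinite Ω m _ _ _ _ hc hg fun s hs _ => ?_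
  rw [setLIntegral_trim hm hc hs, setLIntegral_trim hm hg hs, h s hs,
    ← lintegral_indicator (hm s hs), ← lintegral_indicator (hm s hs)]
  have := lintegral_mul_condMean (μ := μ) (g := s.indicator 1) hm
    (measurable_indicator_one_ennreal hs) hf
  simp only [← Set.indicator_mul_left, Pi.one_apply, one_mul] at this
  exact this

theorem condMean_congr (hm : m ≤ mΩ) (hf : Measurable f) (hf' : Measurable f')
    (h : ∀ k : Ω → ℝ≥0∞, Measurable[m] k → ∫⁻ z, f z * k z ∂μ = ∫⁻ z, f' z * k z ∂μ) :
    condMean m μ f =ᵐ[μ] condMean m μ f' := by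
  refine condMean_unique hm (measurable_condMean hf') hf fun s hs => ?_
  have hs1 : Measurable[m] (s.indicator (1 : Ω → ℝ≥0∞)) :=
    measurable_indicator_one_ennreal hs
  have h1 := h _ hs1
  have h2 := lintegral_mul_condMean (μ := μ) hm hs1 hf'
  rw [← lintegral_indicator (hm s hs), ← lintegral_indicator (hm s hs)]
  simp only [← Set.indicator_mul_left, ← Set.indicator_mul_right, Pi.one_apply, one_mul,
    mul_one] at h1 h2
  exact h2.trans h1.symm

theorem condMean_congr_ae (hm : m ≤ mΩ) (hf : Measurable f) (hf' : Measurable f')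
    (h : f =ᵐ[μ] f') : condMean m μ f =ᵐ[μ] condMean m μ f' :=
  condMean_congr hm hf hf' fun k _ => lintegral_congr_ae (by filter_upwards [h] with z hz; rw [hz])

theorem condMean_mul_left (hm : m ≤ mΩ) (hg : Measurable[m] g) (hf : Measurable f) :
    condMean m μ (fun z => g z * f z) =ᵐ[μ] fun z => g z * condMean m μ f z := by
  have hg' : Measurable g := hg.mono hm le_rfl
  refine condMean_unique hm (hg.mul (measurable_condMean hf)) (hg'.mul hf) fun s hs => ?_
  have := lintegral_mul_condMean (μ := μ) (g := s.indicator g) hm (hg.indicator hs) hf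
  rw [← lintegral_indicator (hm s hs), ← lintegral_indicator (hm s hs)]
  simp only [← Set.indicator_mul_left] at this
  exact this

theorem condMean_add (hf : Measurable f) (z : Ω) :
    condMean m μ (fun z => f z + f' z) z = condMean m μ f z + condMean m μ f' z :=
  lintegral_add_left hf _

theorem condMean_const (c : ℝ≥0∞) (z : Ω) : condMean m μ (fun _ => c) z = c := by
  simp [condMean]

theorem condMean_mono (h : f ≤ f') (z : Ω) : condMean m μ f z ≤ condMean m μ f' z :=
  lintegral_mono h

theorem condMean_of_measurable (hm : m ≤ mΩ) (hg : Measurable[m] g) :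
    condMean m μ g =ᵐ[μ] g :=
  condMean_unique hm hg (hg.mono hm le_rfl) fun _ _ => rfl

/-- The measure on `Ω × Ω` under which, given a point `z` drawn with density `n`, the two
coordinates are independent with densities `p` and `q` with respect to the conditional law of `μ`
given `m` at `z`. -/
noncomputable def condProd (μ : Measure Ω) [IsFiniteMeasure μ] (hm : m ≤ mΩ)
    (n p q : Ω → ℝ≥0∞) : Measure (Ω × Ω) :=
  let κ : Kernel Ω Ω := (condExpKernel μ m).comap id (measurable_id'' hm)
  ((μ ⊗ₘ (κ ×ₖ κ)).withDensity fun a => n a.1 * (p a.2.1 * q a.2.2)).map Prod.snd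

theorem lintegral_condProd (hm : m ≤ mΩ) {n p q : Ω → ℝ≥0∞} (hn : Measurable n)
    (hp : Measurable p) (hq : Measurable q) (hf : Measurable f) (hg : Measurable g) :
    ∫⁻ a, f a.1 * g a.2 ∂(condProd μ hm n p q) =
      ∫⁻ z, n z * (condMean m μ (fun x => p x * f x) z * condMean m μ (fun x => q x * g x) z)
        ∂μ := by
  unfold condProd
  dsimp only
  rw [lintegral_map (by fun_prop) measurable_snd,
    lintegral_withDensity_eq_lintegral_mul _ (by fun_prop) (by fun_prop),
    Measure.lintegral_compProd (by fun_prop)]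
  refine lintegral_congr fun z => ?_
  rw [Kernel.lintegral_prod _ _ _ (by fun_prop)]
  simp only [Pi.mul_apply, Kernel.comap_apply, id]
  calc _ = ∫⁻ x, n z * (p x * f x) * condMean m μ (fun x => q x * g x) z
        ∂(condExpKernel μ m z) := by
        refine lintegral_congr fun x => ?_
        rw [condMean, ← lintegral_const_mul _ (by fun_prop)]
        refine lintegral_congr fun y => by ring
    _ = _ := by
        rw [lintegral_mul_const _ (by fun_prop), lintegral_const_mul _ (by fun_prop), mul_assoc]
        rfl

end CondMean

/-! ### Couplings by separation at a random time, and their causality -/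

section StepCoupling

variable {Ω : Type*} {mΩ : MeasurableSpace Ω} [StandardBorelSpace Ω] {μ : Measure Ω}
  [IsProbabilityMeasure μ]

theorem condMean_mul_eq_zero {m : MeasurableSpace Ω} {mΩ : MeasurableSpace Ω}
    [StandardBorelSpace Ω] {μ : Measure Ω} [IsProbabilityMeasure μ] {f p : Ω → ℝ≥0∞}
    (hp : Measurable p) {z : Ω} (h : condMean m μ p z = 0) :
    condMean m μ (fun x => p x * f x) z = 0 := by
  rw [condMean, lintegral_eq_zero_iff hp] at h
  refine (lintegral_congr_ae ?_).trans lintegral_zero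
  filter_upwards [h] with x hx
  simp [hx]

/-- The coupling of two processes which move together with density `l T`, and which separate at
time `s` with density `l s`, moving from there on independently with densities `p s` and `q s`
given the past up to time `s`. -/
noncomputable def stepCoupling (μ : Measure Ω) [IsFiniteMeasure μ] (F : Filtration ℕ mΩ) (T : ℕ)
    (l n p q : ℕ → Ω → ℝ≥0∞) : Measure (Ω × Ω) :=
  (μ.withDensity (l T)).map (fun x => (x, x)) +
    -- In a causal scheme `p s` and `q s` both have conditional mass `n s`; dividing their product
    -- by `n s` leaves each marginal with its own density.
    ∑ s ∈ Finset.range T, condProd μ (F.le s) (fun z => l s z * (n s z)⁻¹) (p s) (q s)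

/-- Conditions on the densities `l`, `n`, `p`, `q` under which the first process of
`stepCoupling μ F T l n p q` has density `D` and the second process depends on it causally. -/
structure IsCausalScheme (μ : Measure Ω) [IsProbabilityMeasure μ] (F : Filtration ℕ mΩ) (T : ℕ)
    (D : Ω → ℝ≥0∞) (l n p q c r : ℕ → Ω → ℝ≥0∞) : Prop where
  measurable_D : Measurable D
  measurable_l : ∀ s, Measurable[F s] (l s)
  measurable_n : ∀ s, Measurable[F s] (n s)
  measurable_p : ∀ s, Measurable (p s)
  measurable_q : ∀ s, Measurable (q s)
  measurable_c : ∀ s, Measurable[F s] (c s)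
  measurable_r : ∀ s, Measurable[F (s + 1)] (r s)
  n_ne_top : ∀ s z, n s z ≠ ∞
  condMean_p : ∀ s < T, condMean (F s) μ (p s) =ᵐ[μ] n s
  condMean_q : ∀ s < T, condMean (F s) μ (q s) =ᵐ[μ] n s
  -- Separation at time `s` reweights `D` by a function of the path up to `s + 1` only, so the later
  -- future is undisturbed.
  p_eq : ∀ s < T, p s =ᵐ[μ] fun z => r s z * D z
  -- `c s * D` is the density of the first process on the event of no separation before time `s`.
  step : ∀ s < T, (fun z => l s z * p s z + c (s + 1) z * D z) =ᵐ[μ] fun z => c s z * D z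
  last : l T =ᵐ[μ] fun z => c T z * D z

variable {F : Filtration ℕ mΩ} {T : ℕ} {D : Ω → ℝ≥0∞} {l n p q c r : ℕ → Ω → ℝ≥0∞}
  {f f' g : Ω → ℝ≥0∞}

theorem lintegral_stepCoupling (hl : ∀ s, Measurable (l s)) (hn : ∀ s, Measurable (n s))
    (hp : ∀ s, Measurable (p s)) (hq : ∀ s, Measurable (q s)) (hf : Measurable f)
    (hg : Measurable g) :
    ∫⁻ a, f a.1 * g a.2 ∂(stepCoupling μ F T l n p q) =
      ∫⁻ z, l T z * (f z * g z) ∂μ + ∑ s ∈ Finset.range T,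
        ∫⁻ z, l s z * (n s z)⁻¹ * (condMean (F s) μ (fun x => p s x * f x) z *
          condMean (F s) μ (fun x => q s x * g x) z) ∂μ := by
  rw [stepCoupling, lintegral_add_measure, lintegral_finsetSum_measure,
    lintegral_map (by fun_prop) (by fun_prop),
    lintegral_withDensity_eq_lintegral_mul _ (hl T) (by fun_prop)]
  congr 1
  refine Finset.sum_congr rfl fun s _ => ?_
  exact lintegral_condProd (F.le s) (by fun_prop) (hp s) (hq s) hf hg

namespace IsCausalScheme

/-- Up to the separation time both processes coincide, so a function `g` of the second one's past
can be read off the first: `g` leaves the conditional mean of `q s`, whose mass `n s` cancels the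
normalisation. -/
theorem lintegral_separation (h : IsCausalScheme μ F T D l n p q c r) {s : ℕ} (hs : s < T)
    (hf : Measurable f) (hg : Measurable[F s] g) :
    ∫⁻ z, l s z * (n s z)⁻¹ * (condMean (F s) μ (fun x => p s x * f x) z *
      condMean (F s) μ (fun x => q s x * g x) z) ∂μ =
    ∫⁻ z, l s z * p s z * (f z * g z) ∂μ := by
  have h1 : condMean (F s) μ (fun x => q s x * g x) =ᵐ[μ] fun z => g z * n s z := by
    have := condMean_mul_left (μ := μ) (F.le s) hg (h.measurable_q s)
    filter_upwards [this, h.condMean_q s hs] with z hz hz'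
    rw [← hz', ← hz]
    simp only [mul_comm]
  have hpf : Measurable fun x => p s x * f x := (h.measurable_p s).mul hf
  have h2 := lintegral_mul_condMean (μ := μ) (F.le s) ((h.measurable_l s).mul hg) hpf
  calc _ = ∫⁻ z, l s z * g z * condMean (F s) μ (fun x => p s x * f x) z ∂μ := by
        refine lintegral_congr_ae ?_
        filter_upwards [h1, h.condMean_p s hs] with z hz hp
        rw [hz]
        -- Where `n s = 0` its inverse is `∞`, but `p s` has zero conditional mass there and both
        -- sides vanish.
        rcases eq_or_ne (n s z) 0 with h0 | h0
        · rw [condMean_mul_eq_zero (h.measurable_p s) (hp.trans h0)]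
          simp
        · calc _ = l s z * g z * condMean (F s) μ (fun x => p s x * f x) z *
                ((n s z)⁻¹ * n s z) := by ring
            _ = _ := by rw [ENNReal.inv_mul_cancel h0 (h.n_ne_top s z), mul_one]
    _ = _ := h2.trans (lintegral_congr fun z => by simp only [Pi.mul_apply]; ring)

theorem measurable_l' (h : IsCausalScheme μ F T D l n p q c r) (s : ℕ) : Measurable (l s) :=
  (h.measurable_l s).mono (F.le s) le_rfl

theorem measurable_n' (h : IsCausalScheme μ F T D l n p q c r) (s : ℕ) : Measurable (n s) :=
  (h.measurable_n s).mono (F.le s) le_rfl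

theorem sum_after_ae (h : IsCausalScheme μ F T D l n p q c r) {t : ℕ} (ht : t ≤ T) :
    ∀ᵐ z ∂μ, l T z + ∑ s ∈ Finset.Ico t T, l s z * p s z = c t z * D z := by
  induction ht using Nat.decreasingInduction with
  | self => filter_upwards [h.last] with z hz using by simpa using hz
  | of_succ s hs ih =>
    filter_upwards [ih, h.step s hs] with z hz hz'
    rw [Finset.sum_eq_sum_Ico_succ_bot hs, add_left_comm, hz, hz']

theorem sum_after (h : IsCausalScheme μ F T D l n p q c r) (hf : Measurable f) {t : ℕ}
    (ht : t ≤ T) :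
    ∫⁻ z, l T z * f z ∂μ + ∑ s ∈ Finset.Ico t T, ∫⁻ z, l s z * p s z * f z ∂μ =
      ∫⁻ z, c t z * D z * f z ∂μ := by
  have := h.measurable_l'
  have := h.measurable_p
  rw [← lintegral_finsetSum _ fun s _ => by fun_prop, ← lintegral_add_left (by fun_prop)]
  refine lintegral_congr_ae ?_
  filter_upwards [h.sum_after_ae ht] with z hz
  rw [← hz, add_mul, Finset.sum_mul]

/-- Causality in integral form: given the first process up to `t`, the second one's past carries no
more information on the first. The hypothesis `hff` says that `f` and `f'` have the same conditional
mean given `F t` under `D • μ`. -/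
theorem lintegral_congr_of_causal (h : IsCausalScheme μ F T D l n p q c r) {t : ℕ} (ht : t ≤ T)
    (hf : Measurable f) (hf' : Measurable f') (hg : Measurable[F t] g)
    (hff : ∀ k : Ω → ℝ≥0∞, Measurable[F t] k →
      ∫⁻ z, D z * f z * k z ∂μ = ∫⁻ z, D z * f' z * k z ∂μ) :
    ∫⁻ a, f a.1 * g a.2 ∂(stepCoupling μ F T l n p q) =
      ∫⁻ a, f' a.1 * g a.2 ∂(stepCoupling μ F T l n p q) := by
  have hg' : Measurable g := hg.mono (F.le t) le_rfl
  have hD := h.measurable_D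
  -- Separations at times `s ≥ t` collapse into one term, because `g` is then `F s`-measurable.
  have key : ∀ u : Ω → ℝ≥0∞, Measurable u →
      ∫⁻ a, u a.1 * g a.2 ∂(stepCoupling μ F T l n p q) =
      ∑ s ∈ Finset.range t, ∫⁻ z, l s z * (n s z)⁻¹ *
        (condMean (F s) μ (fun x => p s x * u x) z *
          condMean (F s) μ (fun x => q s x * g x) z) ∂μ + ∫⁻ z, D z * u z * (c t z * g z) ∂μ := by
    intro u hu
    rw [lintegral_stepCoupling h.measurable_l' h.measurable_n' h.measurable_p h.measurable_q hu hg',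
      ← Finset.sum_range_add_sum_Ico _ ht, add_left_comm]
    congr 1
    have h1 := h.sum_after (hu.mul hg') ht
    simp only [Pi.mul_apply] at h1
    rw [Finset.sum_congr rfl fun s hs => h.lintegral_separation (Finset.mem_Ico.1 hs).2 hu
      (hg.mono (F.mono (Finset.mem_Ico.1 hs).1) le_rfl), h1]
    refine lintegral_congr fun z => by ring
  rw [key f hf, key f' hf']
  congr 1
  · refine Finset.sum_congr rfl fun s hs => lintegral_congr_ae ?_
    have hst : s + 1 ≤ t := Finset.mem_range.1 hs
    have hr : Measurable (r s) := (h.measurable_r s).mono (F.le _) le_rfl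
    have hps := h.measurable_p s
    have e : ∀ u : Ω → ℝ≥0∞, Measurable u → condMean (F s) μ (fun x => p s x * u x) =ᵐ[μ]
        condMean (F s) μ (fun x => r s x * (D x * u x)) := fun u hu =>
      condMean_congr_ae (F.le s) (by fun_prop) (by fun_prop) (by
        filter_upwards [h.p_eq s (by lia)] with z hz
        rw [hz, mul_assoc])
    have e' : condMean (F s) μ (fun x => r s x * (D x * f x)) =ᵐ[μ]
        condMean (F s) μ (fun x => r s x * (D x * f' x)) :=
      -- For `s < t` the factor `r s` is `F t`-measurable and can join the test function in `hff`.
      condMean_congr (F.le s) (by fun_prop) (by fun_prop) fun k hk => by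
        have := hff (fun z => r s z * k z) (((h.measurable_r s).mono (F.mono hst) le_rfl).mul
          (hk.mono (F.mono (by lia)) le_rfl))
        convert this using 3 <;> ring
    filter_upwards [e f hf, e f' hf', e'] with z h1 h2 h3
    rw [h1, h2, h3]
  · exact hff _ ((h.measurable_c t).mul hg)

theorem lintegral_fst (h : IsCausalScheme μ F T D l n p q c r) (hf : Measurable f) :
    ∫⁻ a, f a.1 ∂(stepCoupling μ F T l n p q) = ∫⁻ z, c 0 z * D z * f z ∂μ := by
  have h1 := lintegral_stepCoupling (μ := μ) (F := F) (T := T) (g := fun _ => 1) h.measurable_l'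
    h.measurable_n' h.measurable_p h.measurable_q hf measurable_const
  simp only [mul_one] at h1
  rw [h1, ← h.sum_after hf (Nat.zero_le _), Finset.range_eq_Ico]
  congr 1
  refine Finset.sum_congr rfl fun s hs => ?_
  have := h.lintegral_separation (g := fun _ => 1) (Finset.mem_Ico.1 hs).2 hf measurable_const
  simpa only [mul_one] using this

end IsCausalScheme

theorem stepCoupling_swap (h : IsCausalScheme μ F T D l n p q c r) (hf : Measurable f)
    (hg : Measurable g) :
    ∫⁻ a, g a.1 * f a.2 ∂(stepCoupling μ F T l n p q) =
      ∫⁻ a, f a.1 * g a.2 ∂(stepCoupling μ F T l n q p) := by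
  rw [lintegral_stepCoupling h.measurable_l' h.measurable_n' h.measurable_p h.measurable_q hg hf,
    lintegral_stepCoupling h.measurable_l' h.measurable_n' h.measurable_q h.measurable_p hf hg]
  congr 1
  · exact lintegral_congr fun z => by ring
  · exact Finset.sum_congr rfl fun s _ => lintegral_congr fun z => by ring

end StepCoupling

/-! ### The density martingale and its two causal schemes -/

section DensityProcess

variable {Ω : Type*} {mΩ : MeasurableSpace Ω} {μ : Measure Ω}
  [IsProbabilityMeasure μ] {F : Filtration ℕ mΩ} {T : ℕ} {M : ℕ → Ω → ℝ≥0}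

/-- `M` is a nonnegative martingale up to time `T`, with initial value `1`. -/
structure IsDensityProcess (μ : Measure Ω) [IsProbabilityMeasure μ] (F : Filtration ℕ mΩ) (T : ℕ)
    (M : ℕ → Ω → ℝ≥0) : Prop where
  measurable : ∀ s, Measurable[F s] (M s)
  zero : M 0 =ᵐ[μ] 1
  lintegral_mul : ∀ s ≤ T, ∀ g : Ω → ℝ≥0∞, Measurable[F s] g →
    ∫⁻ z, g z * M s z ∂μ = ∫⁻ z, g z * M T z ∂μ

/-- The ratio of consecutive values of a density process. -/
noncomputable def densityRatio (M : ℕ → Ω → ℝ≥0) (s : ℕ) (z : Ω) : ℝ≥0 :=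
  -- The value `1` keeps the conditional mean of the ratio equal to `1` where `M s` vanishes.
  if M s z = 0 then 1 else M (s + 1) z / M s z

/-- The density of the common part of the laws of two processes up to time `s`. -/
noncomputable def commonDensity (M : ℕ → Ω → ℝ≥0) (s : ℕ) (z : Ω) : ℝ≥0 :=
  ∏ i ∈ Finset.range s, min 1 (densityRatio M i z)

/-- A path of a density process: it starts at `1` and stays at `0` once it is there. -/
structure IsDensityPath (T : ℕ) (M : ℕ → Ω → ℝ≥0) (z : Ω) : Prop where
  zero : M 0 z = 1
  absorbed : ∀ s < T, M s z = 0 → M (s + 1) z = 0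

theorem commonDensity_succ (s : ℕ) (z : Ω) :
    commonDensity M (s + 1) z = commonDensity M s z * min 1 (densityRatio M s z) :=
  Finset.prod_range_succ _ _

theorem commonDensity_le_one (s : ℕ) (z : Ω) : commonDensity M s z ≤ 1 :=
  Finset.prod_le_one' fun _ _ => min_le_left _ _

namespace IsDensityPath

variable {z : Ω} (h : IsDensityPath T M z)
include h

theorem mul_ratio {s : ℕ} (hs : s < T) : M s z * densityRatio M s z = M (s + 1) z := by
  rw [densityRatio]
  split_ifs with h0
  · rw [h0, h.absorbed s hs h0, zero_mul]
  · exact mul_div_cancel₀ _ h0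

theorem commonDensity_le {s : ℕ} (hs : s ≤ T) : commonDensity M s z ≤ M s z := by
  induction s with
  | zero => simp [commonDensity, h.zero]
  | succ s ih =>
    rw [commonDensity_succ, ← h.mul_ratio hs]
    exact mul_le_mul' (ih (by lia)) (min_le_right _ _)

theorem ne_zero {s : ℕ} (hs : s ≤ T) (hT : M T z ≠ 0) : M s z ≠ 0 := by
  induction hs using Nat.decreasingInduction with
  | self => exact hT
  | of_succ s hs ih => exact fun h0 => ih (h.absorbed s hs h0)

end IsDensityPath

theorem one_tsub_add_min (a : ℝ≥0) : (1 - a) + min 1 a = 1 := by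
  rcases le_total a 1 with h | h
  · rw [min_eq_right h, tsub_add_cancel_of_le h]
  · rw [min_eq_left h, tsub_eq_zero_of_le h, zero_add]

theorem tsub_one_add_min (a : ℝ≥0) : (a - 1) + min 1 a = a := by
  rcases le_total a 1 with h | h
  · rw [min_eq_right h, tsub_eq_zero_of_le h, zero_add]
  · rw [min_eq_left h, tsub_add_cancel_of_le h]

theorem one_tsub_add_self (a : ℝ≥0) : (1 - a) + a = (a - 1) + 1 := by
  rcases le_total a 1 with h | h
  · rw [tsub_eq_zero_of_le h, tsub_add_cancel_of_le h, zero_add]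
  · rw [tsub_eq_zero_of_le h, tsub_add_cancel_of_le h, zero_add]

namespace IsDensityProcess

variable (h : IsDensityProcess μ F T M)
include h

theorem measurable' (s : ℕ) : Measurable (M s) := (h.measurable s).mono (F.le s) le_rfl

theorem measurable_of_le {s t : ℕ} (hst : s ≤ t) : Measurable[F t] (M s) :=
  (h.measurable s).mono (F.mono hst) le_rfl

/-- Absorption at zero follows by testing the martingale property against the indicator of `M s =
0`. -/
theorem ae_isDensityPath : ∀ᵐ z ∂μ, IsDensityPath T M z := by
  have h1 : ∀ s, ∀ᵐ z ∂μ, s < T → M s z = 0 → M (s + 1) z = 0 := by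
    intro s
    by_cases hs : s < T
    swap
    · exact Filter.Eventually.of_forall fun z h => absurd h hs
    have hS : MeasurableSet[F s] {z | M s z = 0} := h.measurable s (measurableSet_singleton 0)
    have hi := measurable_indicator_one_ennreal hS
    have e1 := h.lintegral_mul s hs.le _ hi
    have e2 := h.lintegral_mul (s + 1) hs _ (hi.mono (F.mono (Nat.le_succ s)) le_rfl)
    rw [← e2] at e1
    have e3 : ∫⁻ z, {z | M s z = 0}.indicator 1 z * (M s z : ℝ≥0∞) ∂μ = 0 := by
      refine (lintegral_congr fun z => ?_).trans lintegral_zero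
      by_cases hz : M s z = 0 <;> simp [hz]
    have hm : Measurable fun z => {z | M s z = 0}.indicator 1 z * (M (s + 1) z : ℝ≥0∞) :=
      (hi.mono (F.le s) le_rfl).mul (h.measurable' _).coe_nnreal_ennreal
    rw [e3, eq_comm, lintegral_eq_zero_iff hm] at e1
    filter_upwards [e1] with z hz _ h0
    simpa [Set.indicator, h0] using hz
  filter_upwards [h.zero, ae_all_iff.2 h1] with z hz hz'
  exact ⟨hz, hz'⟩

theorem measurable_ratio (s : ℕ) : Measurable[F (s + 1)] (densityRatio M s) := by
  have h1 := h.measurable (s + 1)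
  have h2 := h.measurable_of_le (Nat.le_succ s)
  exact Measurable.ite (h2 (measurableSet_singleton 0)) measurable_const (h1.div h2)

theorem measurable_ratio' (s : ℕ) : Measurable (densityRatio M s) :=
  (h.measurable_ratio s).mono (F.le _) le_rfl

theorem measurable_commonDensity (s : ℕ) : Measurable[F s] (commonDensity M s) := by
  unfold commonDensity
  refine Finset.measurable_fun_prod _ fun i hi => measurable_const.min
    ((h.measurable_ratio i).mono (F.mono (Finset.mem_range.1 hi)) le_rfl)

variable [StandardBorelSpace Ω]

theorem condMean_succ {s : ℕ} (hs : s < T) :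
    condMean (F s) μ (fun z => (M (s + 1) z : ℝ≥0∞)) =ᵐ[μ] fun z => (M s z : ℝ≥0∞) := by
  have h1 : Measurable[F s] fun z => (M s z : ℝ≥0∞) := (h.measurable s).coe_nnreal_ennreal
  have h2 := (h.measurable' (s + 1)).coe_nnreal_ennreal
  refine (condMean_congr (F.le s) h2 (h1.mono (F.le s) le_rfl) fun k hk => ?_).trans
    (condMean_of_measurable (F.le s) h1)
  have e1 := h.lintegral_mul s hs.le k hk
  have e2 := h.lintegral_mul (s + 1) hs k (hk.mono (F.mono (Nat.le_succ s)) le_rfl)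
  simp only [mul_comm _ (k _)]
  rw [e1, e2]

theorem condMean_ratio {s : ℕ} (hs : s < T) :
    condMean (F s) μ (fun z => (densityRatio M s z : ℝ≥0∞)) =ᵐ[μ] 1 := by
  have hS : MeasurableSet[F s] {z | M s z = 0} := h.measurable s (measurableSet_singleton 0)
  have hi := measurable_indicator_one_ennreal hS
  have hinv : Measurable[F s] fun z => (((M s z)⁻¹ : ℝ≥0) : ℝ≥0∞) :=
    (h.measurable s).inv.coe_nnreal_ennreal
  have e1 := condMean_mul_left (μ := μ) (F.le s) hinv (h.measurable' (s + 1)).coe_nnreal_ennreal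
  have e2 := condMean_of_measurable (μ := μ) (F.le s) hi
  have e0 : (fun z => (densityRatio M s z : ℝ≥0∞)) = fun z =>
      {z | M s z = 0}.indicator 1 z + (((M s z)⁻¹ : ℝ≥0) : ℝ≥0∞) * (M (s + 1) z : ℝ≥0∞) := by
    funext z
    by_cases hz : M s z = 0
    · simp [densityRatio, hz]
    · simp [densityRatio, hz, div_eq_inv_mul]
  rw [e0]
  filter_upwards [e1, e2, h.condMean_succ hs] with z h1 h2 h3
  rw [condMean_add (hi.mono (F.le s) le_rfl), h1, h2, h3]
  by_cases hz : M s z = 0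
  · simp [hz]
  · rw [← ENNReal.coe_mul, inv_mul_cancel₀ hz]
    simp [hz]

/-- The ratio has conditional mean `1`, so its excess over `1` and its deficit below `1` balance. -/
theorem condMean_tsub_one {s : ℕ} (hs : s < T) :
    condMean (F s) μ (fun z => ((densityRatio M s z - 1 : ℝ≥0) : ℝ≥0∞)) =ᵐ[μ]
      condMean (F s) μ (fun z => ((1 - densityRatio M s z : ℝ≥0) : ℝ≥0∞)) := by
  have hr := h.measurable_ratio' s
  filter_upwards [h.condMean_ratio hs] with z hz
  have e1 := condMean_add (m := F s) (μ := μ) (z := z) (f' := fun _ => 1)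
    (f := fun z => ((densityRatio M s z - 1 : ℝ≥0) : ℝ≥0∞)) (by fun_prop)
  have e2 := condMean_add (m := F s) (μ := μ) (z := z) (f' := fun z => (densityRatio M s z : ℝ≥0∞))
    (f := fun z => ((1 - densityRatio M s z : ℝ≥0) : ℝ≥0∞)) (by fun_prop)
  rw [condMean_const] at e1
  rw [hz, Pi.one_apply] at e2
  refine (ENNReal.add_left_inj ENNReal.one_ne_top).1 (e1.symm.trans (Eq.trans ?_ e2))
  congr 1
  funext z
  exact_mod_cast (one_tsub_add_self _).symm

/-- The factor `M T / M (s + 1)` makes the second process continue as under `ν`. It has conditional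
mean `1` given `F (s + 1)` where `M (s + 1) ≠ 0`; elsewhere the excess is zero. -/
theorem condMean_ahead {s : ℕ} (hs : s < T) :
    condMean (F s) μ (fun z =>
      (((densityRatio M s z - 1) / M (s + 1) z * M T z : ℝ≥0) : ℝ≥0∞)) =ᵐ[μ]
      condMean (F s) μ (fun z => ((1 - densityRatio M s z : ℝ≥0) : ℝ≥0∞)) := by
  have hr := h.measurable_ratio' s
  have hM := h.measurable' (s + 1)
  have hMT := h.measurable' T
  refine Filter.EventuallyEq.trans ?_ (h.condMean_tsub_one hs)
  refine condMean_congr (F.le s) (by fun_prop) (by fun_prop) fun k hk => ?_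
  have e1 := h.lintegral_mul (s + 1) hs
    (fun z => (((densityRatio M s z - 1) / M (s + 1) z : ℝ≥0) : ℝ≥0∞) * k z)
    ((((h.measurable_ratio s).sub_const 1).div (h.measurable _)).coe_nnreal_ennreal.mul
      (hk.mono (F.mono (Nat.le_succ s)) le_rfl))
  calc _ = ∫⁻ z, (((densityRatio M s z - 1) / M (s + 1) z : ℝ≥0) : ℝ≥0∞) * k z * M T z ∂μ :=
        lintegral_congr fun z => by push_cast; ring
    _ = _ := e1.symm
    _ = _ := by
      refine lintegral_congr_ae ?_
      filter_upwards [h.ae_isDensityPath] with z hz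
      by_cases h0 : M (s + 1) z = 0
      · have : densityRatio M s z - 1 = 0 := by
          rw [densityRatio]
          split_ifs <;> simp [h0]
        simp [this]
      · rw [mul_right_comm, ← ENNReal.coe_mul, div_mul_cancel₀ _ h0]

theorem isCausalScheme_left : IsCausalScheme μ F T (fun _ => 1)
    (fun s z => (commonDensity M s z : ℝ≥0∞))
    (fun s => condMean (F s) μ (fun z => ((1 - densityRatio M s z : ℝ≥0) : ℝ≥0∞)))
    (fun s z => ((1 - densityRatio M s z : ℝ≥0) : ℝ≥0∞))
    (fun s z => (((densityRatio M s z - 1) / M (s + 1) z * M T z : ℝ≥0) : ℝ≥0∞))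
    (fun s z => (commonDensity M s z : ℝ≥0∞))
    (fun s z => ((1 - densityRatio M s z : ℝ≥0) : ℝ≥0∞)) where
  measurable_D := measurable_const
  measurable_l s := (h.measurable_commonDensity s).coe_nnreal_ennreal
  measurable_n s := measurable_condMean
    (measurable_const.sub (h.measurable_ratio' s)).coe_nnreal_ennreal
  measurable_p s := (measurable_const.sub (h.measurable_ratio' s)).coe_nnreal_ennreal
  measurable_q s := ((((h.measurable_ratio' s).sub_const 1).div (h.measurable' _)).mul
    (h.measurable' T)).coe_nnreal_ennreal
  measurable_c s := (h.measurable_commonDensity s).coe_nnreal_ennreal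
  measurable_r s := (measurable_const.sub (h.measurable_ratio s)).coe_nnreal_ennreal
  n_ne_top s z := by
    refine ne_top_of_le_ne_top ENNReal.one_ne_top ((condMean_mono (f' := fun _ => 1) ?_ z).trans
      (condMean_const 1 z).le)
    intro x
    exact ENNReal.coe_le_one_iff.2 tsub_le_self
  condMean_p s _ := ae_eq_refl _
  condMean_q s hs := h.condMean_ahead hs
  p_eq s _ := by simp
  step s _ := Filter.Eventually.of_forall fun z => by
    dsimp only
    rw [commonDensity_succ, mul_one, mul_one]
    norm_cast
    rw [← mul_add, one_tsub_add_min, mul_one]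
  last := by simp

/-- The same coupling seen from the second process: `p` and `q` trade places and the no-separation
weight is taken relative to `ν`. -/
theorem isCausalScheme_right : IsCausalScheme μ F T (fun z => (M T z : ℝ≥0∞))
    (fun s z => (commonDensity M s z : ℝ≥0∞))
    (fun s => condMean (F s) μ (fun z => ((1 - densityRatio M s z : ℝ≥0) : ℝ≥0∞)))
    (fun s z => (((densityRatio M s z - 1) / M (s + 1) z * M T z : ℝ≥0) : ℝ≥0∞))
    (fun s z => ((1 - densityRatio M s z : ℝ≥0) : ℝ≥0∞))
    (fun s z => ((commonDensity M s z / M s z : ℝ≥0) : ℝ≥0∞))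
    (fun s z => (((densityRatio M s z - 1) / M (s + 1) z : ℝ≥0) : ℝ≥0∞)) where
  measurable_D := (h.measurable' T).coe_nnreal_ennreal
  measurable_l := h.isCausalScheme_left.measurable_l
  measurable_n := h.isCausalScheme_left.measurable_n
  measurable_p := h.isCausalScheme_left.measurable_q
  measurable_q := h.isCausalScheme_left.measurable_p
  measurable_c s := ((h.measurable_commonDensity s).div (h.measurable s)).coe_nnreal_ennreal
  measurable_r s := (((h.measurable_ratio s).sub_const 1).div (h.measurable _)).coe_nnreal_ennreal
  n_ne_top := h.isCausalScheme_left.n_ne_top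
  condMean_p := h.isCausalScheme_left.condMean_q
  condMean_q := h.isCausalScheme_left.condMean_p
  p_eq s _ := by simp
  step s hs := by
    filter_upwards [h.ae_isDensityPath] with z hz
    norm_cast
    rw [commonDensity_succ]
    rcases eq_or_ne (M T z) 0 with h0 | h0
    · simp [h0]
    have h1 := hz.ne_zero hs.le h0
    have h2 := hz.ne_zero (Nat.succ_le_of_lt hs) h0
    have h3 : densityRatio M s z ≠ 0 := by
      intro h4
      rw [← hz.mul_ratio hs, h4, mul_zero] at h2
      exact h2 rfl
    calc _ = commonDensity M s z * ((densityRatio M s z - 1) + min 1 (densityRatio M s z)) /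
          M (s + 1) z * M T z := by ring
      _ = _ := by
        rw [tsub_one_add_min, ← hz.mul_ratio hs]
        field_simp
  last := by
    filter_upwards [h.ae_isDensityPath] with z hz
    norm_cast
    rcases eq_or_ne (M T z) 0 with h0 | h0
    -- Where `M T = 0` the division is void, but the common density is at most `M T`, hence zero.
    · have := hz.commonDensity_le le_rfl
      rw [h0] at this
      simp [h0, nonpos_iff_eq_zero.1 this]
    · rw [div_mul_cancel₀ _ h0]

end IsDensityProcess

end DensityProcess

/-! ### Pointwise and integrated entropy inequalities -/

section EntropyInequalities

/-- From `u ≤ sinh u` at `u = -log x`, which reads `-log x ≤ (x⁻¹ - x) / 2`. -/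
theorem sq_one_sub_le_two_mul_klFun {x : ℝ} (h0 : 0 ≤ x) (h1 : x ≤ 1) :
    (1 - x) ^ 2 ≤ 2 * klFun x := by
  rcases h0.eq_or_lt with rfl | h0
  · norm_num [klFun]
  have h2 : 0 ≤ Real.log x⁻¹ := Real.log_nonneg ((one_le_inv₀ h0).2 h1)
  have h3 := Real.self_le_sinh_iff.2 h2
  rw [Real.sinh_log (inv_pos.2 h0), Real.log_inv, inv_inv] at h3
  have h4 : x * (-Real.log x) ≤ x * ((x⁻¹ - x) / 2) := mul_le_mul_of_nonneg_left h3 h0.le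
  have h5 : x * ((x⁻¹ - x) / 2) = (1 - x ^ 2) / 2 := by field_simp
  rw [klFun]
  nlinarith

/-- From `log x ≥ 2 (x - 1) / (x + 1)`, then `x + 1 ≤ 2 x`. -/
theorem sq_sub_one_le_two_mul_self_mul_klFun {x : ℝ} (h1 : 1 ≤ x) :
    (x - 1) ^ 2 ≤ 2 * x * klFun x := by
  have h2 := Real.le_log_one_add_of_nonneg (x := x - 1) (by linarith)
  rw [show 1 + (x - 1) = x by ring, show x - 1 + 2 = x + 1 by ring,
    div_le_iff₀ (by linarith)] at h2
  have h3 : (x - 1) ^ 2 ≤ (x + 1) * klFun x := by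
    rw [klFun]
    nlinarith
  have h4 := klFun_nonneg (x := x) (by linarith)
  nlinarith

/-- Fenchel–Young: `klFun` is the convex conjugate of `exp y - 1`. -/
theorem mul_add_one_le_klFun_add {x y : ℝ} (hx : 0 ≤ x) : x * y + 1 ≤ klFun x + Real.exp y := by
  rcases hx.eq_or_lt with rfl | hx
  · simp [klFun, Real.exp_nonneg]
  have h1 := Real.add_one_le_exp (y - Real.log x)
  have h2 : Real.exp y = x * Real.exp (y - Real.log x) := by
    rw [Real.exp_sub, Real.exp_log hx]
    field_simp
  rw [klFun, h2]
  nlinarith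

variable {Ω : Type*} {mΩ : MeasurableSpace Ω} {μ : Measure Ω}

theorem sq_lintegral_mul_le {f g : Ω → ℝ≥0∞} (hf : Measurable f) (hg : Measurable g) :
    (∫⁻ z, f z * g z ∂μ) ^ 2 ≤ (∫⁻ z, f z ^ 2 ∂μ) * ∫⁻ z, g z ^ 2 ∂μ := by
  have h := ENNReal.lintegral_mul_le_Lp_mul_Lq μ Real.HolderConjugate.two_two
    hf.aemeasurable hg.aemeasurable
  simp only [ENNReal.rpow_two, Pi.mul_apply] at h
  calc _ ≤ ((∫⁻ z, f z ^ 2 ∂μ) ^ (1 / 2 : ℝ) * (∫⁻ z, g z ^ 2 ∂μ) ^ (1 / 2 : ℝ)) ^ 2 := by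
        gcongr
    _ = _ := by
      rw [mul_pow, ← ENNReal.rpow_two, ← ENNReal.rpow_two, ← ENNReal.rpow_mul, ← ENNReal.rpow_mul]
      norm_num

/-- The entropy of a probability density. -/
noncomputable def densityEntropy (μ : Measure Ω) (D : Ω → ℝ≥0) : ℝ≥0∞ :=
  ∫⁻ z, ENNReal.ofReal (klFun (D z)) ∂μ

theorem densityEntropy_one : densityEntropy μ (fun _ => 1) = 0 := by
  simp [densityEntropy, klFun_one]

variable {D : Ω → ℝ≥0}

@[fun_prop]
theorem measurable_ofReal_klFun {D : Ω → ℝ≥0} (hD : Measurable D) :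
    Measurable fun z => ENNReal.ofReal (klFun (D z)) :=
  (measurable_klFun.comp hD.coe_nnreal_real).ennreal_ofReal

/-- The Gibbs variational inequality, with `L` an upper bound for `log ∫ exp G`: Fenchel–Young at `x
= D`, `y = G - L`, integrated. -/
theorem lintegral_mul_le_densityEntropy_add [IsProbabilityMeasure μ] {G : Ω → ℝ≥0}
    (hG : Measurable G) (hD : Measurable D) {L : ℝ≥0}
    (hL : ∫⁻ z, ENNReal.ofReal (Real.exp (G z - L)) ∂μ ≤ 1) (hD1 : ∫⁻ z, (D z : ℝ≥0∞) ∂μ = 1) :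
    ∫⁻ z, (G z : ℝ≥0∞) * D z ∂μ ≤ densityEntropy μ D + L := by
  have h1 : ∀ z, (G z : ℝ≥0∞) * D z + 1 ≤ ENNReal.ofReal (klFun (D z)) + L * D z +
      ENNReal.ofReal (Real.exp (G z - L)) := by
    intro z
    have := mul_add_one_le_klFun_add (x := D z) (y := G z - L) (D z).2
    have h0 := klFun_nonneg (x := (D z : ℝ)) (D z).2
    have e1 : (G z : ℝ≥0∞) * D z + 1 = ENNReal.ofReal (G z * D z + 1) := by
      rw [ENNReal.ofReal_add (by positivity) zero_le_one, ENNReal.ofReal_mul (by positivity)]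
      simp
    have e2 : (L : ℝ≥0∞) * D z = ENNReal.ofReal (L * D z) := by
      rw [ENNReal.ofReal_mul (by positivity)]
      simp
    rw [e1, e2, ← ENNReal.ofReal_add h0 (by positivity),
      ← ENNReal.ofReal_add (add_nonneg h0 (by positivity)) (by positivity)]
    apply ENNReal.ofReal_le_ofReal
    linarith
  have h2 := lintegral_mono (μ := μ) h1
  rw [lintegral_add_left (by fun_prop), lintegral_add_left (by fun_prop),
    lintegral_add_left (by fun_prop), lintegral_const_mul _ (by fun_prop), hD1] at h2
  simp only [lintegral_const, measure_univ, mul_one] at h2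
  exact (ENNReal.add_le_add_iff_right ENNReal.one_ne_top).1 (h2.trans (by gcongr; exact le_rfl))

theorem lintegral_mul_tsub_one_sq_le [IsProbabilityMeasure μ] {φ : Ω → ℝ≥0} (hφ : Measurable φ)
    (hD : Measurable D) {a L : ℝ≥0}
    (hL : ∫⁻ z, ENNReal.ofReal (Real.exp ((a * φ z ^ 2 : ℝ≥0) - L)) ∂μ ≤ 1)
    (hD1 : ∫⁻ z, (D z : ℝ≥0∞) ∂μ = 1) :
    a * (∫⁻ z, (φ z : ℝ≥0∞) * (D z - 1 : ℝ≥0) ∂μ) ^ 2 ≤ (1 + L) * (2 * densityEntropy μ D) := by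
  set H := densityEntropy μ D with hH
  have h1 : a * ∫⁻ z, (φ z : ℝ≥0∞) ^ 2 * D z ∂μ ≤ H + L := by
    have := lintegral_mul_le_densityEntropy_add (G := fun z => a * φ z ^ 2) (by fun_prop) hD hL hD1
    rw [← lintegral_const_mul _ (by fun_prop)]
    refine le_trans (lintegral_mono fun z => ?_) this
    rw [← mul_assoc]
    push_cast
    exact le_rfl
  have hsqrt : ∀ x : ℝ≥0, ((NNReal.sqrt x : ℝ≥0) : ℝ≥0∞) ^ 2 = x := fun x => by
    rw [← ENNReal.coe_pow, NNReal.sq_sqrt]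
  have hs : Measurable fun z => ((NNReal.sqrt (D z) : ℝ≥0) : ℝ≥0∞) :=
    (NNReal.continuous_sqrt.measurable.comp hD).coe_nnreal_ennreal
  have hs' : Measurable fun z => (((D z - 1) / NNReal.sqrt (D z) : ℝ≥0) : ℝ≥0∞) :=
    ((hD.sub_const 1).div (NNReal.continuous_sqrt.measurable.comp hD)).coe_nnreal_ennreal
  -- For `H ≤ 1`, Cauchy–Schwarz with the split `φ √D · (D - 1)⁺ / √D` gives a factor `2 H`, and `H
  -- + L ≤ 1 + L`. For `H ≥ 1` the crude bound `(D - 1)⁺ ≤ D` suffices, since then `H + L ≤ (1 + L)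
  -- 2H`.
  rcases le_total H 1 with hle | hge
  · have h2 := sq_lintegral_mul_le (μ := μ) (f := fun z => (φ z : ℝ≥0∞) * NNReal.sqrt (D z))
      (g := fun z => (((D z - 1) / NNReal.sqrt (D z) : ℝ≥0) : ℝ≥0∞)) (by fun_prop) hs'
    have e1 : ∀ z, (φ z : ℝ≥0∞) * NNReal.sqrt (D z) * ((D z - 1) / NNReal.sqrt (D z) : ℝ≥0) =
        (φ z : ℝ≥0∞) * (D z - 1 : ℝ≥0) := by
      intro z
      rw [mul_assoc, ← ENNReal.coe_mul]
      congr 2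
      rcases eq_or_ne (D z) 0 with h0 | h0
      · simp [h0]
      · exact mul_div_cancel₀ _ (by simpa using h0)
    have e2 : ∫⁻ z, (((D z - 1) / NNReal.sqrt (D z) : ℝ≥0) : ℝ≥0∞) ^ 2 ∂μ ≤ 2 * H := by
      rw [hH, densityEntropy, ← lintegral_const_mul _ (by fun_prop)]
      refine lintegral_mono fun z => ?_
      rcases le_total (D z) 1 with hz | hz
      · simp [tsub_eq_zero_of_le hz]
      · have hz' : (1 : ℝ) ≤ D z := hz
        have := sq_sub_one_le_two_mul_self_mul_klFun hz'
        have e : (((D z - 1) / NNReal.sqrt (D z) : ℝ≥0) : ℝ≥0∞) ^ 2 =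
            ENNReal.ofReal ((D z - 1) ^ 2 / D z) := by
          rw [← ENNReal.coe_pow, div_pow, NNReal.sq_sqrt, ENNReal.ofReal,
            ← Real.toNNReal_coe (r := (D z - 1) ^ 2 / D z)]
          push_cast [NNReal.coe_sub hz]
          rfl
        have e' : (2 : ℝ≥0∞) = ENNReal.ofReal 2 := by simp
        dsimp only
        rw [e, e', ← ENNReal.ofReal_mul zero_le_two]
        apply ENNReal.ofReal_le_ofReal
        rw [div_le_iff₀ (by linarith)]
        linarith
    simp only [e1, mul_pow, hsqrt] at h2
    calc _ ≤ a * ((∫⁻ z, (φ z : ℝ≥0∞) ^ 2 * D z ∂μ) * (2 * H)) := by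
          gcongr
          exact h2.trans (by gcongr)
      _ = (a * ∫⁻ z, (φ z : ℝ≥0∞) ^ 2 * D z ∂μ) * (2 * H) := (mul_assoc _ _ _).symm
      _ ≤ (1 + L) * (2 * H) := by
        gcongr
        exact h1.trans (by gcongr)
  · have h2 := sq_lintegral_mul_le (μ := μ) (f := fun z => (φ z : ℝ≥0∞) * NNReal.sqrt (D z))
      (g := fun z => ((NNReal.sqrt (D z) : ℝ≥0) : ℝ≥0∞)) (by fun_prop) hs
    simp only [mul_pow, hsqrt, hD1, mul_one, mul_assoc, ← pow_two] at h2
    calc _ ≤ a * (∫⁻ z, (φ z : ℝ≥0∞) * D z ∂μ) ^ 2 := by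
          gcongr
          exact tsub_le_self
      _ ≤ H + L := le_trans (by gcongr) h1
      _ ≤ H + H + L * (2 * H) := by
        gcongr
        · exact le_self_add
        · exact le_mul_of_one_le_right' (hge.trans (by rw [two_mul]; exact le_self_add))
      _ = _ := by ring

end EntropyInequalities

/-! ### Chain rule for entropy along the density process -/

section EntropyChain

variable {Ω : Type*} {mΩ : MeasurableSpace Ω} {μ : Measure Ω}
  [IsProbabilityMeasure μ] {F : Filtration ℕ mΩ} {T : ℕ} {M : ℕ → Ω → ℝ≥0}

/-- The chain rule before averaging. The signed term `a log a` is split into its positive and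
negative parts to stay within `[0, ∞]`; once `x` averages to `1` these parts cancel. -/
theorem klFun_mul_add (a x : ℝ≥0) (hx : a = 0 → x = 1) :
    (a : ℝ≥0∞) * ENNReal.ofReal (klFun x) + ENNReal.ofReal (klFun a) +
        ENNReal.ofReal (a * Real.log a) * x + ENNReal.ofReal (-(a * Real.log a)) =
      ENNReal.ofReal (klFun (a * x : ℝ≥0)) + ENNReal.ofReal (a * Real.log a) +
        ENNReal.ofReal (-(a * Real.log a)) * x := by
  have key : (a : ℝ) * klFun x + klFun a + a * Real.log a * x =
      klFun (a * x : ℝ≥0) + a * Real.log a := by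
    rcases eq_or_ne a 0 with rfl | ha
    · simp [klFun]
    rcases eq_or_ne x 0 with rfl | hx0
    · simp [klFun]; ring
    push_cast
    rw [klFun, klFun, klFun, Real.log_mul (by exact_mod_cast ha) (by exact_mod_cast hx0)]
    ring
  have k1 := klFun_nonneg (x := (x : ℝ)) x.2
  have k2 := klFun_nonneg (x := (a : ℝ)) a.2
  have k3 := klFun_nonneg (x := ((a * x : ℝ≥0) : ℝ)) (a * x).2
  have ea : (a : ℝ≥0∞) = ENNReal.ofReal a := by simp
  have ex : (x : ℝ≥0∞) = ENNReal.ofReal x := by simp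
  have ha0 : (0 : ℝ) ≤ a := a.2
  have hx0 : (0 : ℝ) ≤ x := x.2
  rcases le_total 0 (a * Real.log a) with h | h
  · rw [ENNReal.ofReal_of_nonpos (p := -_) (by linarith), zero_mul, add_zero, add_zero, ea, ex,
      ← ENNReal.ofReal_mul ha0, ← ENNReal.ofReal_mul h, ← ENNReal.ofReal_add (by positivity) k2,
      ← ENNReal.ofReal_add (by positivity) (by positivity), ← ENNReal.ofReal_add k3 h, key]
  · have h' : 0 ≤ -(a * Real.log a) := by linarith
    rw [ENNReal.ofReal_of_nonpos h, zero_mul, add_zero, add_zero, ea, ex,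
      ← ENNReal.ofReal_mul ha0, ← ENNReal.ofReal_mul h', ← ENNReal.ofReal_add (by positivity) k2,
      ← ENNReal.ofReal_add (by positivity) h', ← ENNReal.ofReal_add k3 (by positivity)]
    congr 1
    linarith

namespace IsDensityProcess

variable [StandardBorelSpace Ω] (h : IsDensityProcess μ F T M)
include h

theorem densityEntropy_succ {s : ℕ} (hs : s < T) :
    ∫⁻ z, (M s z : ℝ≥0∞) * ENNReal.ofReal (klFun (densityRatio M s z)) ∂μ +
      densityEntropy μ (M s) = densityEntropy μ (M (s + 1)) := by
  have hm := h.measurable' s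
  have hm' := h.measurable' (s + 1)
  have hr := h.measurable_ratio' s
  have hlog : Measurable[F s] fun z => (M s z : ℝ) * Real.log (M s z) :=
    (h.measurable s).coe_nnreal_real.mul (Real.measurable_log.comp (h.measurable s).coe_nnreal_real)
  set c : Ω → ℝ≥0∞ := fun z => ENNReal.ofReal ((M s z : ℝ) * Real.log (M s z))
  set e : Ω → ℝ≥0∞ := fun z => ENNReal.ofReal (-((M s z : ℝ) * Real.log (M s z)))
  have hc : Measurable[F s] c := hlog.ennreal_ofReal
  have he : Measurable[F s] e := hlog.neg.ennreal_ofReal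
  have hc' := hc.mono (F.le s) le_rfl
  have := he.mono (F.le s) le_rfl
  set A : Ω → ℝ≥0∞ := fun z => (M s z : ℝ≥0∞) * ENNReal.ofReal (klFun (densityRatio M s z)) +
    ENNReal.ofReal (klFun (M s z)) with hA
  set B : Ω → ℝ≥0∞ := fun z => ENNReal.ofReal (klFun (M (s + 1) z)) with hB
  have hAm : Measurable A := by fun_prop
  have hBm : Measurable B := by fun_prop
  have hrE : Measurable fun z => (densityRatio M s z : ℝ≥0∞) := by fun_prop
  have hcr : Measurable fun z => c z * densityRatio M s z := hc'.mul hrE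
  have h1 : (fun z => A z + (c z * densityRatio M s z + e z)) =ᵐ[μ]
      fun z => B z + (c z + e z * densityRatio M s z) := by
    filter_upwards [h.ae_isDensityPath] with z hz
    have := klFun_mul_add (M s z) (densityRatio M s z) (fun h0 => by simp [densityRatio, h0])
    rw [hz.mul_ratio hs] at this
    rw [← add_assoc, ← add_assoc]
    exact this
  have h2 := condMean_congr_ae (μ := μ) (F.le s) (by fun_prop) (by fun_prop) h1
  have h3 : condMean (F s) μ A =ᵐ[μ] condMean (F s) μ B := by
    filter_upwards [h2, h.condMean_ratio hs, condMean_mul_left (μ := μ) (F.le s) hc hrE,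
      condMean_mul_left (μ := μ) (F.le s) he hrE, condMean_of_measurable (μ := μ) (F.le s) hc,
      condMean_of_measurable (μ := μ) (F.le s) he] with z h2 hr1 h4 h5 h6 h7
    rw [condMean_add hAm, condMean_add hBm, condMean_add hcr, condMean_add hc', h4, h5,
      h6, h7, hr1, Pi.one_apply, mul_one, mul_one] at h2
    -- Both sides now carry the same `c z + e z`, which is finite and can be cancelled.
    exact (ENNReal.add_left_inj (ENNReal.add_ne_top.2
      ⟨ENNReal.ofReal_ne_top, ENNReal.ofReal_ne_top⟩)).1 h2
  have h4 : ∫⁻ z, A z ∂μ = ∫⁻ z, B z ∂μ := by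
    have e1 := lintegral_mul_condMean (μ := μ) (g := fun _ => 1) (F.le s) measurable_const hAm
    have e2 := lintegral_mul_condMean (μ := μ) (g := fun _ => 1) (F.le s) measurable_const hBm
    simp only [one_mul] at e1 e2
    rw [← e1, ← e2]
    exact lintegral_congr_ae h3
  rw [hA, lintegral_add_left (by fun_prop)] at h4
  exact h4

theorem sum_entropy_le (t : ℕ) (ht : t ≤ T) :
    ∑ s ∈ Finset.range t,
      ∫⁻ z, (M s z : ℝ≥0∞) * ENNReal.ofReal (klFun (densityRatio M s z)) ∂μ ≤
    densityEntropy μ (M t) := by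
  induction t with
  | zero => simp
  | succ t ih =>
    rw [Finset.sum_range_succ, ← h.densityEntropy_succ ht, add_comm]
    gcongr
    exact ih (by lia)

/-- Cauchy–Schwarz over the `T` times costs the factor `T`; bounding `w s ^ 2` by `M s` yields the
terms of the chain rule. -/
theorem lintegral_sq_separation_le :
    ∫⁻ z, ((∑ s ∈ Finset.range T, commonDensity M s z * (1 - densityRatio M s z) : ℝ≥0) :
      ℝ≥0∞) ^ 2 ∂μ ≤ T * (2 * densityEntropy μ (M T)) := by
  have hm := h.measurable'
  have hr := h.measurable_ratio'
  calc _ ≤ ∫⁻ z, ∑ s ∈ Finset.range T, T * (2 * ((M s z : ℝ≥0∞) *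
        ENNReal.ofReal (klFun (densityRatio M s z)))) ∂μ := by
        refine lintegral_mono_ae ?_
        filter_upwards [h.ae_isDensityPath] with z hz
        have h1 : (∑ s ∈ Finset.range T, commonDensity M s z * (1 - densityRatio M s z)) ^ 2 ≤
            T * ∑ s ∈ Finset.range T, (commonDensity M s z * (1 - densityRatio M s z)) ^ 2 := by
          have := sq_sum_le_card_mul_sum_sq (s := Finset.range T) (f := fun s =>
            ((commonDensity M s z * (1 - densityRatio M s z) : ℝ≥0) : ℝ))
          rw [Finset.card_range] at this
          exact_mod_cast this
        have h2 : ∀ s ∈ Finset.range T,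
            (((commonDensity M s z * (1 - densityRatio M s z)) ^ 2 : ℝ≥0) : ℝ≥0∞) ≤
            2 * ((M s z : ℝ≥0∞) * ENNReal.ofReal (klFun (densityRatio M s z))) := by
          intro s hs
          have hw : commonDensity M s z ^ 2 ≤ M s z :=
            (pow_le_of_le_one zero_le (commonDensity_le_one s z) two_ne_zero).trans
              (hz.commonDensity_le (Finset.mem_range.1 hs).le)
          have h3 : (((1 - densityRatio M s z) ^ 2 : ℝ≥0) : ℝ≥0∞) ≤
              2 * ENNReal.ofReal (klFun (densityRatio M s z)) := by
            rcases le_total (densityRatio M s z) 1 with h1 | h1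
            · have := sq_one_sub_le_two_mul_klFun (densityRatio M s z).2 h1
              have e2 : (2 : ℝ≥0∞) = ENNReal.ofReal 2 := by simp
              rw [e2, ← ENNReal.ofReal_mul zero_le_two, ← ENNReal.ofReal_coe_nnreal]
              apply ENNReal.ofReal_le_ofReal
              push_cast [NNReal.coe_sub h1]
              exact this
            · simp [tsub_eq_zero_of_le h1]
          rw [mul_pow, ENNReal.coe_mul, mul_left_comm]
          gcongr
        calc _ ≤ (((T * ∑ s ∈ Finset.range T,
              (commonDensity M s z * (1 - densityRatio M s z)) ^ 2 : ℝ≥0)) : ℝ≥0∞) := by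
              rw [← ENNReal.coe_pow]
              exact ENNReal.coe_le_coe.2 h1
          _ = T * ∑ s ∈ Finset.range T,
              (((commonDensity M s z * (1 - densityRatio M s z)) ^ 2 : ℝ≥0) : ℝ≥0∞) := by
              push_cast
              rfl
          _ ≤ _ := by
              rw [← Finset.mul_sum]
              gcongr with s hs
              exact h2 s hs
    _ = ∑ s ∈ Finset.range T, ∫⁻ z, T * (2 * ((M s z : ℝ≥0∞) *
        ENNReal.ofReal (klFun (densityRatio M s z)))) ∂μ :=
        lintegral_finsetSum _ fun s _ => by fun_prop
    _ = T * (2 * ∑ s ∈ Finset.range T,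
        ∫⁻ z, (M s z : ℝ≥0∞) * ENNReal.ofReal (klFun (densityRatio M s z)) ∂μ) := by
        rw [Finset.mul_sum, Finset.mul_sum]
        refine Finset.sum_congr rfl fun s _ => ?_
        rw [lintegral_const_mul _ (by fun_prop), lintegral_const_mul _ (by fun_prop)]
    _ ≤ _ := by
        gcongr
        exact h.sum_entropy_le T le_rfl

end IsDensityProcess

end EntropyChain

/-! ### Conditional independence from an integral criterion -/

section CondIndep

variable {E Ω γ : Type*} {mE : MeasurableSpace E} [StandardBorelSpace E]
  {mΩ : MeasurableSpace Ω} [StandardBorelSpace Ω] [mγ : MeasurableSpace γ]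

theorem condIndepFun_of_lintegral_eq {π : Measure E} [IsProbabilityMeasure π] {ρ : Measure Ω}
    [IsProbabilityMeasure ρ] {X Y : E → Ω} (hX : Measurable X) (hY : Measurable Y)
    {u : Ω → γ} (hu : Measurable u)
    (hle : MeasurableSpace.comap (fun e => u (X e)) mγ ≤ mE)
    (h : ∀ f f' g : Ω → ℝ≥0∞, Measurable f → Measurable f' →
      Measurable[MeasurableSpace.comap u mγ] g →
      (∀ k : Ω → ℝ≥0∞, Measurable[MeasurableSpace.comap u mγ] k →
        ∫⁻ z, f z * k z ∂ρ = ∫⁻ z, f' z * k z ∂ρ) →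
      ∫⁻ e, f (X e) * g (Y e) ∂π = ∫⁻ e, f' (X e) * g (Y e) ∂π) :
    CondIndepFun (MeasurableSpace.comap (fun e => u (X e)) mγ) hle
      (fun e => u (Y e)) X π := by
  have hm := hu.comap_le
  rw [condIndepFun_iff_condExp_inter_preimage_eq_mul (f := fun e => u (Y e)) (hu.comp hY) hX]
  intro s t hs ht
  have ht1 := measurable_indicator_one_ennreal ht
  set G : Ω → ℝ≥0∞ := condMean (MeasurableSpace.comap u mγ) ρ (t.indicator 1) with hG
  have hGm : Measurable[MeasurableSpace.comap u mγ] G := measurable_condMean ht1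
  have hGm' : Measurable G := hGm.mono hm le_rfl
  have hG1 : ∀ z, G z ≤ 1 := fun z =>
    (condMean_mono (f' := fun _ => 1) (Set.indicator_le_self _ _) z).trans (condMean_const 1 z).le
  have hGX : StronglyMeasurable[MeasurableSpace.comap (fun e => u (X e)) mγ] fun e => (G (X e)).toReal := by
    refine Measurable.stronglyMeasurable (Measurable.ennreal_toReal ?_)
    exact hGm.comp (by
      rintro _ ⟨a, ha, rfl⟩
      exact ⟨a, ha, rfl⟩)
  have key : ∀ s : Set γ, MeasurableSet s →
      π⟦(fun e => u (Y e)) ⁻¹' s ∩ X ⁻¹' t|MeasurableSpace.comap (fun e => u (X e)) mγ⟧ =ᵐ[π]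
      π⟦(fun e => u (Y e)) ⁻¹' s|MeasurableSpace.comap (fun e => u (X e)) mγ⟧ * fun e => (G (X e)).toReal := by
    intro s hs
    have hsY : MeasurableSet ((fun e => u (Y e)) ⁻¹' s) := (hu.comp hY) hs
    have hi1 : Integrable (((fun e => u (Y e)) ⁻¹' s).indicator (fun _ => (1 : ℝ))) π :=
      (integrable_const 1).indicator hsY
    have hi2 : Integrable (((fun e => u (Y e)) ⁻¹' s).indicator (fun _ => (1 : ℝ)) *
        fun e => (G (X e)).toReal) π := by
      refine hi1.mul_bdd (c := 1) (hGX.mono hle).aestronglyMeasurable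
        (Filter.Eventually.of_forall fun e => ?_)
      rw [Real.norm_of_nonneg ENNReal.toReal_nonneg]
      exact ENNReal.toReal_le_of_le_ofReal zero_le_one (by simpa using hG1 (X e))
    have hi3 : Integrable (((fun e => u (Y e)) ⁻¹' s ∩ X ⁻¹' t).indicator (fun _ => (1 : ℝ))) π :=
      (integrable_const 1).indicator (hsY.inter (hX ht))
    refine Filter.EventuallyEq.trans ?_ (condExp_mul_of_stronglyMeasurable_right hGX hi2 hi1)
    refine (ae_eq_condExp_of_forall_setIntegral_eq hle hi3
      (fun _ _ _ => integrable_condExp.integrableOn) ?_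
      stronglyMeasurable_condExp.aestronglyMeasurable).symm
    rintro _ ⟨a, ha, rfl⟩ -
    rw [setIntegral_condExp hle hi2 ⟨a, ha, rfl⟩]
    have haX : MeasurableSet ((fun e => u (X e)) ⁻¹' a) := (hu.comp hX) ha
    have hua : MeasurableSet[MeasurableSpace.comap u mγ] (u ⁻¹' a) := ⟨a, ha, rfl⟩
    have hus : MeasurableSet[MeasurableSpace.comap u mγ] (u ⁻¹' s) := ⟨s, hs, rfl⟩
    have ha1 := measurable_indicator_one_ennreal hua
    have hs1 := measurable_indicator_one_ennreal hus
    -- The indicator of `t` is replaced by its conditional mean `G` given `u`, localised to `u ⁻¹'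
    -- a`.
    have h1 := h (fun z => (u ⁻¹' a).indicator 1 z * t.indicator 1 z)
      (fun z => (u ⁻¹' a).indicator 1 z * G z) ((u ⁻¹' s).indicator 1)
      ((ha1.mono hm le_rfl).mul ht1) ((ha1.mono hm le_rfl).mul hGm') hs1 (fun k hk => by
        have := lintegral_mul_condMean (μ := ρ) hm (ha1.mul hk) ht1
        simp only [Pi.mul_apply] at this
        simp only [mul_right_comm _ _ (k _)]
        exact this.symm)
    rw [← integral_indicator haX, ← integral_indicator haX]
    have hms : Measurable fun e => (u ⁻¹' s).indicator (1 : Ω → ℝ≥0∞) (Y e) :=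
      (hs1.mono hm le_rfl).comp hY
    have hma : Measurable fun e => (u ⁻¹' a).indicator (1 : Ω → ℝ≥0∞) (X e) :=
      (ha1.mono hm le_rfl).comp hX
    have hfin : ∀ (v : Set Ω) (z : Ω), v.indicator (1 : Ω → ℝ≥0∞) z ≤ 1 := fun v z =>
      Set.indicator_le_self _ (1 : Ω → ℝ≥0∞) z
    have e1 : ((fun e => u (X e)) ⁻¹' a).indicator
        (((fun e => u (Y e)) ⁻¹' s).indicator (fun _ => (1 : ℝ)) * fun e => (G (X e)).toReal) =
        fun e => ((u ⁻¹' a).indicator (1 : Ω → ℝ≥0∞) (X e) * G (X e) *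
          (u ⁻¹' s).indicator 1 (Y e)).toReal := by
      funext e
      by_cases h1 : u (X e) ∈ a <;> by_cases h2 : u (Y e) ∈ s <;> simp [h1, h2]
    have e2 : ((fun e => u (X e)) ⁻¹' a).indicator
        (((fun e => u (Y e)) ⁻¹' s ∩ X ⁻¹' t).indicator (fun _ => (1 : ℝ))) =
        fun e => ((u ⁻¹' a).indicator (1 : Ω → ℝ≥0∞) (X e) * t.indicator 1 (X e) *
          (u ⁻¹' s).indicator 1 (Y e)).toReal := by
      funext e
      by_cases h1 : u (X e) ∈ a <;> by_cases h2 : u (Y e) ∈ s <;> by_cases h3 : X e ∈ t <;>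
        simp [h1, h2, h3]
    rw [e1, e2, integral_toReal, integral_toReal, h1]
    · exact ((hma.mul (ht1.comp hX)).mul hms).aemeasurable
    · exact Filter.Eventually.of_forall fun e => (mul_le_one' (mul_le_one' (hfin _ _) (hfin _ _))
        (hfin _ _)).trans_lt ENNReal.one_lt_top
    · exact ((hma.mul (hGm'.comp hX)).mul hms).aemeasurable
    · exact Filter.Eventually.of_forall fun e => (mul_le_one' (mul_le_one' (hfin _ _) (hG1 _))
        (hfin _ _)).trans_lt ENNReal.one_lt_top
  have hXt : π⟦X ⁻¹' t|MeasurableSpace.comap (fun e => u (X e)) mγ⟧ =ᵐ[π] fun e => (G (X e)).toReal := by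
    -- Taking `s` to be everything identifies `G (X e)` as the conditional probability of `X ∈ t`.
    have := key Set.univ MeasurableSet.univ
    simp only [Set.preimage_univ, Set.univ_inter, Set.indicator_univ] at this
    rw [condExp_const hle] at this
    filter_upwards [this] with e he
    rw [he]
    simp
  filter_upwards [key s hs, hXt] with e he he'
  rw [he', ← Pi.mul_apply (g := fun e => (G (X e)).toReal)]
  exact he

end CondIndep

/-! ### The greedy coupling: marginals, causality and cost -/

section SeparationCoupling

variable {Ω : Type*} {mΩ : MeasurableSpace Ω} [StandardBorelSpace Ω] {μ : Measure Ω}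
  [IsProbabilityMeasure μ] {F : Filtration ℕ mΩ} {T : ℕ} {M : ℕ → Ω → ℝ≥0}

/-- The coupling of `μ` and `M T • μ` which successively couples the conditional laws of the next
step in a maximal way, until the two processes separate. -/
noncomputable def separationCoupling (μ : Measure Ω) [IsProbabilityMeasure μ] (F : Filtration ℕ mΩ)
    (T : ℕ) (M : ℕ → Ω → ℝ≥0) : Measure (Ω × Ω) :=
  stepCoupling μ F T (fun s z => (commonDensity M s z : ℝ≥0∞))
    (fun s => condMean (F s) μ (fun z => ((1 - densityRatio M s z : ℝ≥0) : ℝ≥0∞)))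
    (fun s z => ((1 - densityRatio M s z : ℝ≥0) : ℝ≥0∞))
    (fun s z => (((densityRatio M s z - 1) / M (s + 1) z * M T z : ℝ≥0) : ℝ≥0∞))

namespace IsDensityProcess

variable (h : IsDensityProcess μ F T M)
include h

theorem map_fst_separationCoupling : (separationCoupling μ F T M).map Prod.fst = μ := by
  refine Measure.ext_of_lintegral _ fun f hf => ?_
  rw [lintegral_map hf measurable_fst, separationCoupling, h.isCausalScheme_left.lintegral_fst hf]
  simp [commonDensity]

theorem map_snd_separationCoupling :
    (separationCoupling μ F T M).map Prod.snd = μ.withDensity fun z => (M T z : ℝ≥0∞) := by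
  have hT := (h.measurable' T).coe_nnreal_ennreal
  refine Measure.ext_of_lintegral _ fun f hf => ?_
  have h1 := stepCoupling_swap h.isCausalScheme_left hf (g := fun _ => 1) measurable_const
  simp only [one_mul, mul_one] at h1
  rw [lintegral_map hf measurable_snd, separationCoupling, h1,
    h.isCausalScheme_right.lintegral_fst hf, lintegral_withDensity_eq_lintegral_mul _ hT hf]
  refine lintegral_congr_ae ?_
  filter_upwards [h.ae_isDensityPath] with z hz
  simp [commonDensity, hz.zero]

theorem lintegral_separationCoupling_fst {t : ℕ} (ht : t ≤ T) {f f' g : Ω → ℝ≥0∞}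
    (hf : Measurable f) (hf' : Measurable f') (hg : Measurable[F t] g)
    (hff : ∀ k : Ω → ℝ≥0∞, Measurable[F t] k → ∫⁻ z, f z * k z ∂μ = ∫⁻ z, f' z * k z ∂μ) :
    ∫⁻ a, f a.1 * g a.2 ∂(separationCoupling μ F T M) =
      ∫⁻ a, f' a.1 * g a.2 ∂(separationCoupling μ F T M) :=
  h.isCausalScheme_left.lintegral_congr_of_causal ht hf hf' hg (by simpa only [one_mul] using hff)

theorem lintegral_separationCoupling_snd {t : ℕ} (ht : t ≤ T) {f f' g : Ω → ℝ≥0∞}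
    (hf : Measurable f) (hf' : Measurable f') (hg : Measurable[F t] g)
    (hff : ∀ k : Ω → ℝ≥0∞, Measurable[F t] k →
      ∫⁻ z, f z * k z ∂(μ.withDensity fun z => (M T z : ℝ≥0∞)) =
        ∫⁻ z, f' z * k z ∂(μ.withDensity fun z => (M T z : ℝ≥0∞))) :
    ∫⁻ a, f a.2 * g a.1 ∂(separationCoupling μ F T M) =
      ∫⁻ a, f' a.2 * g a.1 ∂(separationCoupling μ F T M) := by
  have hg' : Measurable g := hg.mono (F.le t) le_rfl
  have hT := (h.measurable' T).coe_nnreal_ennreal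
  simp only [mul_comm _ (g _), separationCoupling]
  rw [stepCoupling_swap h.isCausalScheme_left hf hg',
    stepCoupling_swap h.isCausalScheme_left hf' hg']
  refine h.isCausalScheme_right.lintegral_congr_of_causal ht hf hf' hg fun k hk => ?_
  have hk' : Measurable k := hk.mono (F.le t) le_rfl
  have := hff k hk
  rw [lintegral_withDensity_eq_lintegral_mul _ hT (by fun_prop),
    lintegral_withDensity_eq_lintegral_mul _ hT (by fun_prop)] at this
  simpa only [Pi.mul_apply, mul_assoc] using this

theorem lintegral_cost_le {Φ : Ω × Ω → ℝ≥0∞} (hΦ : Measurable Φ) {φ : Ω → ℝ≥0∞}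
    (hφ : Measurable φ) {C : ℝ≥0∞} (hdiag : ∀ x, Φ (x, x) = 0)
    (hle : ∀ a, Φ a ≤ C * (φ a.1 + φ a.2)) :
    ∫⁻ a, Φ a ∂(separationCoupling μ F T M) ≤ C * (2 * ∫⁻ z, φ z *
      (∑ s ∈ Finset.range T, commonDensity M s z * (1 - densityRatio M s z) : ℝ≥0) ∂μ +
      ∫⁻ z, φ z * (M T z - 1 : ℝ≥0) ∂μ) := by
  have hl := h.isCausalScheme_left
  have hr := h.isCausalScheme_right
  have hw := hl.measurable_l'
  have hn := hl.measurable_n'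
  have hp := hl.measurable_p
  have hq := hr.measurable_p
  have hm := h.measurable' T
  have hwp : ∀ s, Measurable fun z => (commonDensity M s z : ℝ≥0∞) *
      (1 - densityRatio M s z : ℝ≥0) * φ z := fun s => ((hw s).mul (hp s)).mul hφ
  have hwq : ∀ s, Measurable fun z => (commonDensity M s z : ℝ≥0∞) *
      ((densityRatio M s z - 1) / M (s + 1) z * M T z : ℝ≥0) * φ z :=
    fun s => ((hw s).mul (hq s)).mul hφ
  rw [separationCoupling, stepCoupling, lintegral_add_measure, lintegral_finsetSum_measure,
    lintegral_map hΦ (by fun_prop)]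
  simp only [hdiag, lintegral_zero, zero_add]
  calc _ ≤ ∑ s ∈ Finset.range T, C *
        (∫⁻ z, (commonDensity M s z : ℝ≥0∞) * (1 - densityRatio M s z : ℝ≥0) * φ z ∂μ +
        ∫⁻ z, (commonDensity M s z : ℝ≥0∞) *
          ((densityRatio M s z - 1) / M (s + 1) z * M T z : ℝ≥0) * φ z ∂μ) := by
        refine Finset.sum_le_sum fun s hs => ?_
        refine (lintegral_mono hle).trans ?_
        rw [lintegral_const_mul _ (by fun_prop), lintegral_add_left (by fun_prop)]
        gcongr
        · have e1 := lintegral_condProd (μ := μ) (F.le s)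
            (n := fun z => (commonDensity M s z : ℝ≥0∞) * (condMean (F s) μ
              (fun z => ((1 - densityRatio M s z : ℝ≥0) : ℝ≥0∞)) z)⁻¹)
            ((hw s).mul (hn s).inv) (hp s) (hq s) hφ
            (g := fun _ => 1) measurable_const
          simp only [mul_one] at e1
          have e2 := hl.lintegral_separation (Finset.mem_range.1 hs) hφ (g := fun _ => 1)
            measurable_const
          simp only [mul_one] at e2
          rw [e1, e2]
        · have e1 := lintegral_condProd (μ := μ) (F.le s)
            (n := fun z => (commonDensity M s z : ℝ≥0∞) * (condMean (F s) μ
              (fun z => ((1 - densityRatio M s z : ℝ≥0) : ℝ≥0∞)) z)⁻¹)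
            ((hw s).mul (hn s).inv) (hp s) (hq s)
            (f := fun _ => 1) measurable_const hφ
          simp only [mul_one, one_mul] at e1
          have e2 := hr.lintegral_separation (Finset.mem_range.1 hs) hφ (g := fun _ => 1)
            measurable_const
          simp only [mul_one] at e2
          rw [e1, ← e2]
          exact (lintegral_congr fun z => by ring).le
    _ = C * (∫⁻ z, φ z * (∑ s ∈ Finset.range T,
          (commonDensity M s z : ℝ≥0∞) * (1 - densityRatio M s z : ℝ≥0)) ∂μ +
        ∫⁻ z, φ z * (∑ s ∈ Finset.range T, (commonDensity M s z : ℝ≥0∞) *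
          ((densityRatio M s z - 1) / M (s + 1) z * M T z : ℝ≥0)) ∂μ) := by
        rw [← Finset.mul_sum, Finset.sum_add_distrib,
          ← lintegral_finsetSum _ fun s _ => hwp s, ← lintegral_finsetSum _ fun s _ => hwq s]
        simp only [← Finset.sum_mul, mul_comm (φ _)]
    _ ≤ C * (∫⁻ z, φ z * (∑ s ∈ Finset.range T,
          commonDensity M s z * (1 - densityRatio M s z) : ℝ≥0) ∂μ +
        ∫⁻ z, (φ z * (∑ s ∈ Finset.range T,
          commonDensity M s z * (1 - densityRatio M s z) : ℝ≥0) +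
          φ z * (M T z - 1 : ℝ≥0)) ∂μ) := by
        refine mul_le_mul' le_rfl (add_le_add ?_ ?_)
        · refine lintegral_mono fun z => ?_
          push_cast
          exact le_rfl
        · refine lintegral_mono_ae ?_
          filter_upwards [h.ae_isDensityPath, hl.sum_after_ae (Nat.zero_le T),
            hr.sum_after_ae (Nat.zero_le T)] with z hz h1 h2
          rw [← mul_add]
          gcongr
          simp only [commonDensity, Finset.range_zero, Finset.prod_empty, hz.zero, div_one,
            ENNReal.coe_one, one_mul, Nat.Ico_zero_eq_range] at h1 h2
          norm_cast at h1 h2 ⊢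
          change ∑ s ∈ Finset.range T, commonDensity M s z * _ ≤ _
          change commonDensity M T z + ∑ s ∈ Finset.range T, commonDensity M s z * _ = _ at h1
          change commonDensity M T z + ∑ s ∈ Finset.range T, commonDensity M s z * _ = _ at h2
          -- Adding the common density turns the claim into `M T ≤ 1 + (M T - 1)⁺`.
          refine (add_le_add_iff_left (commonDensity M T z)).1 ?_
          rw [h2, ← add_assoc, h1]
          exact le_add_tsub
    _ = _ := by
        have hA : Measurable fun z => φ z * (∑ s ∈ Finset.range T,
          commonDensity M s z * (1 - densityRatio M s z) : ℝ≥0) := by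
          have h1 := fun s => (h.measurable_commonDensity s).mono (F.le s) le_rfl
          have h2 := h.measurable_ratio'
          fun_prop
        rw [lintegral_add_left hA, ← add_assoc, two_mul]

end IsDensityProcess

theorem le_ofReal_sqrt_mul_rpow {a c : ℝ≥0} (ha : a ≠ 0) {x K : ℝ≥0∞}
    (h : a * x ^ 2 ≤ c * K) : x ≤ ENNReal.ofReal (√(c : ℝ) / √(a : ℝ)) * K ^ (1 / 2 : ℝ) := by
  have h1 : x ^ 2 ≤ ENNReal.ofReal (c / a) * K := by
    have ha' : (a : ℝ≥0∞) ≠ 0 := by simpa using ha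
    have e : ENNReal.ofReal (c / a) = (a : ℝ≥0∞)⁻¹ * c := by
      rw [← ENNReal.coe_inv ha, ← ENNReal.coe_mul, ← ENNReal.ofReal_coe_nnreal]
      congr 1
      push_cast
      ring
    calc x ^ 2 = (a : ℝ≥0∞)⁻¹ * (a * x ^ 2) := by
          rw [← mul_assoc, ENNReal.inv_mul_cancel ha' ENNReal.coe_ne_top, one_mul]
      _ ≤ (a : ℝ≥0∞)⁻¹ * (c * K) := by gcongr
      _ = _ := by rw [e, mul_assoc]
  have h2 := ENNReal.rpow_le_rpow h1 (z := 1 / 2) (by norm_num)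
  rw [← ENNReal.rpow_two, ← ENNReal.rpow_mul, ENNReal.mul_rpow_of_nonneg _ _ (by norm_num),
    ENNReal.ofReal_rpow_of_nonneg (by positivity) (by norm_num), ← Real.sqrt_eq_rpow,
    Real.sqrt_div (show (0 : ℝ) ≤ c from c.2)] at h2
  norm_num at h2 ⊢
  exact h2

namespace IsDensityProcess

theorem lintegral_weight_le (h : IsDensityProcess μ F T M) {φ : Ω → ℝ≥0}
    (hφ : Measurable φ) {a L : ℝ≥0} (ha : a ≠ 0)
    (hL : ∫⁻ z, ENNReal.ofReal (Real.exp ((a * φ z ^ 2 : ℝ≥0) - L)) ∂μ ≤ 1)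
    (hM : ∫⁻ z, (M T z : ℝ≥0∞) ∂μ = 1) :
    2 * ∫⁻ z, φ z *
      (∑ s ∈ Finset.range T, commonDensity M s z * (1 - densityRatio M s z) : ℝ≥0) ∂μ +
      ∫⁻ z, φ z * (M T z - 1 : ℝ≥0) ∂μ ≤
    ENNReal.ofReal ((2 * √(T : ℝ) + 1) / √(a : ℝ) * (1 + (L : ℝ)) ^ (1 / 2 : ℝ)) *
      (2 * densityEntropy μ (M T)) ^ (1 / 2 : ℝ) := by
  have h1 := fun s => (h.measurable_commonDensity s).mono (F.le s) le_rfl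
  have h2 := h.measurable_ratio'
  have hI : a * ∫⁻ z, (φ z : ℝ≥0∞) ^ 2 ∂μ ≤ L := by
    -- The density `1` has zero entropy, so this is Jensen's inequality for the exponential.
    have := lintegral_mul_le_densityEntropy_add (μ := μ) (G := fun z => a * φ z ^ 2)
      (D := fun _ => 1) (by fun_prop) measurable_const hL (by simp)
    rw [densityEntropy_one, zero_add] at this
    rw [← lintegral_const_mul _ (by fun_prop)]
    simpa using this
  have hX := sq_lintegral_mul_le (μ := μ) (f := fun z => (φ z : ℝ≥0∞)) (g := fun z =>
    ((∑ s ∈ Finset.range T, commonDensity M s z * (1 - densityRatio M s z) : ℝ≥0) : ℝ≥0∞))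
    (by fun_prop) (by fun_prop)
  have hX' := le_ofReal_sqrt_mul_rpow (c := (1 + L) * T) (K := 2 * densityEntropy μ (M T)) ha <|
    calc _ ≤ a * ((∫⁻ z, (φ z : ℝ≥0∞) ^ 2 ∂μ) * (T * (2 * densityEntropy μ (M T)))) := by
          gcongr
          exact hX.trans (by gcongr; exact h.lintegral_sq_separation_le)
      _ = (a * ∫⁻ z, (φ z : ℝ≥0∞) ^ 2 ∂μ) * (T * (2 * densityEntropy μ (M T))) :=
          (mul_assoc _ _ _).symm
      _ ≤ (1 + L) * (T * (2 * densityEntropy μ (M T))) := by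
          gcongr
          exact hI.trans le_add_self
      _ = _ := by push_cast; ring
  have hY := le_ofReal_sqrt_mul_rpow (c := 1 + L) ha
    (by simpa using lintegral_mul_tsub_one_sq_le hφ (h.measurable' T) hL hM)
  refine (add_le_add (mul_le_mul_right hX' 2) hY).trans (le_of_eq ?_)
  have e2 : (2 : ℝ≥0∞) = ENNReal.ofReal 2 := by simp
  rw [← mul_assoc]
  nth_rw 1 [e2]
  rw [← ENNReal.ofReal_mul zero_le_two, ← add_mul, ← ENNReal.ofReal_add (by positivity)
    (by positivity), ← Real.sqrt_eq_rpow]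
  congr 2
  push_cast
  rw [Real.sqrt_mul (by positivity)]
  ring

end IsDensityProcess

end SeparationCoupling

/-! ### The density process of `ν` with respect to `μ` -/

section RnDerivProcess

variable {Ω : Type*} {mΩ : MeasurableSpace Ω} {μ ν : Measure Ω}
  [IsProbabilityMeasure μ] [IsProbabilityMeasure ν] {F : Filtration ℕ mΩ} {T : ℕ}

theorem lintegral_rnDeriv_eq_one (hac : ν ≪ μ) : ∫⁻ z, ν.rnDeriv μ z ∂μ = 1 := by
  rw [Measure.lintegral_rnDeriv hac, measure_univ]

variable [StandardBorelSpace Ω]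

/-- The density of `ν` with respect to `μ` on the `σ`-algebra `F s`. -/
noncomputable def rnDerivProcess (μ ν : Measure Ω) [IsProbabilityMeasure μ] (F : Filtration ℕ mΩ)
    (s : ℕ) (z : Ω) : ℝ≥0 :=
  (condMean (F s) μ (ν.rnDeriv μ) z).toNNReal

theorem coe_rnDerivProcess_ae_eq (hac : ν ≪ μ) (s : ℕ) :
    (fun z => (rnDerivProcess μ ν F s z : ℝ≥0∞)) =ᵐ[μ] condMean (F s) μ (ν.rnDeriv μ) := by
  have hR := Measure.measurable_rnDeriv ν μ
  have h1 := lintegral_mul_condMean (μ := μ) (g := fun _ => 1) (F.le s) measurable_const hR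
  simp only [one_mul, lintegral_rnDeriv_eq_one hac] at h1
  have h2 := ae_lt_top ((measurable_condMean (m := F s) (μ := μ) hR).mono (F.le s) le_rfl)
    (h1.trans_ne ENNReal.one_ne_top)
  filter_upwards [h2] with z hz
  exact ENNReal.coe_toNNReal hz.ne

theorem rnDerivProcess_last_ae_eq (hac : ν ≪ μ) (hT : F T = mΩ) :
    (fun z => (rnDerivProcess μ ν F T z : ℝ≥0∞)) =ᵐ[μ] ν.rnDeriv μ :=
  (coe_rnDerivProcess_ae_eq hac T).trans
    (condMean_of_measurable (F.le T) (by rw [hT]; exact Measure.measurable_rnDeriv ν μ))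

theorem isDensityProcess_rnDerivProcess (hac : ν ≪ μ) (h0 : F 0 = ⊥) :
    IsDensityProcess μ F T (rnDerivProcess μ ν F) where
  measurable s := (measurable_condMean (Measure.measurable_rnDeriv ν μ)).ennreal_toNNReal
  zero := by
    have h1 : condMean (F 0) μ (ν.rnDeriv μ) =ᵐ[μ] fun _ => 1 := by
      refine condMean_unique (F.le 0) measurable_const (Measure.measurable_rnDeriv ν μ)
        fun s hs => ?_
      rw [h0, MeasurableSpace.measurableSet_bot_iff] at hs
      rcases hs with rfl | rfl
      · simp
      · simp [lintegral_rnDeriv_eq_one hac]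
    filter_upwards [h1] with z hz
    simp [rnDerivProcess, hz]
  lintegral_mul s hs g hg := by
    have key : ∀ t, Measurable[F t] g → ∫⁻ z, g z * rnDerivProcess μ ν F t z ∂μ =
        ∫⁻ z, g z * ν.rnDeriv μ z ∂μ := fun t ht => by
      rw [← lintegral_mul_condMean (F.le t) ht (Measure.measurable_rnDeriv ν μ)]
      refine lintegral_congr_ae ?_
      filter_upwards [coe_rnDerivProcess_ae_eq (F := F) hac t] with z hz
      rw [hz]
    rw [key s hg, key T (hg.mono (F.mono hs) le_rfl)]

theorem withDensity_rnDerivProcess (hac : ν ≪ μ) (hT : F T = mΩ) :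
    μ.withDensity (fun z => (rnDerivProcess μ ν F T z : ℝ≥0∞)) = ν := by
  rw [withDensity_congr_ae (rnDerivProcess_last_ae_eq hac hT), Measure.withDensity_rnDeriv_eq _ _ hac]

theorem densityEntropy_rnDerivProcess (hac : ν ≪ μ) (hT : F T = mΩ) :
    densityEntropy μ (rnDerivProcess μ ν F T) = klDiv ν μ := by
  rw [klDiv_eq_lintegral_klFun_of_ac hac, densityEntropy]
  refine lintegral_congr_ae ?_
  filter_upwards [rnDerivProcess_last_ae_eq hac hT] with z hz
  rw [← hz, ENNReal.coe_toReal]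

end RnDerivProcess

/-! ### Path space and conclusion -/

section Path

variable {T : ℕ} {X : Fin T → Type*} [∀ i, MeasurableSpace (X i)]

/-- The filtration generated by the coordinate process on the path space. -/
def pathFiltration (X : Fin T → Type*) [∀ i, MeasurableSpace (X i)] :
    Filtration ℕ (MeasurableSpace.pi : MeasurableSpace (∀ i, X i)) where
  seq t := MeasurableSpace.comap (pathUpTo t) inferInstance
  mono' s t hst := by
    have h : Measurable fun (y : ∀ i : {i : Fin T // i.val < t}, X i.val)
        (i : {i : Fin T // i.val < s}) => y ⟨i.val, i.2.trans_le hst⟩ :=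
      measurable_pi_lambda _ fun i => measurable_pi_apply _
    have e : pathUpTo (X := X) s = (fun (y : ∀ i : {i : Fin T // i.val < t}, X i.val)
        (i : {i : Fin T // i.val < s}) => y ⟨i.val, i.2.trans_le hst⟩) ∘ pathUpTo t := rfl
    change MeasurableSpace.comap (pathUpTo (X := X) s) _ ≤ _
    rw [e, ← MeasurableSpace.comap_comp]
    exact MeasurableSpace.comap_mono h.comap_le
  le' t := (measurable_pathUpTo t).comap_le

theorem pathFiltration_zero : pathFiltration X 0 = ⊥ := by
  have : Subsingleton (∀ i : {i : Fin T // i.val < 0}, X i.val) :=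
    ⟨fun _ _ => funext fun i => absurd i.2 (Nat.not_lt_zero _)⟩
  refine le_bot_iff.1 ?_
  rintro _ ⟨s, -, rfl⟩
  rcases s.eq_empty_or_nonempty with rfl | hs
  · exact MeasurableSpace.measurableSet_empty _
  · rw [Subsingleton.eq_univ_of_nonempty hs]
    exact @MeasurableSet.univ _ ⊥

theorem pathFiltration_last : pathFiltration X T = MeasurableSpace.pi := by
  refine le_antisymm ((pathFiltration X).le T) ?_
  refine iSup_le fun i => ?_
  have e : (fun x : ∀ i, X i => x i) =
      (fun y : ∀ i : {i : Fin T // i.val < T}, X i.val => y ⟨i, i.2⟩) ∘ pathUpTo T := rfl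
  rw [e, ← MeasurableSpace.comap_comp]
  have hi : Measurable fun y : ∀ i : {i : Fin T // i.val < T}, X i.val => y ⟨i, i.2⟩ :=
    measurable_pi_apply _
  exact MeasurableSpace.comap_mono hi.comap_le

variable [∀ i, StandardBorelSpace (X i)] {μ ν : Measure (∀ i, X i)}

theorem adaptedWasserstein_rpow_le {d : (∀ i, X i) → (∀ i, X i) → ℝ} {p : ℝ} (hp : 0 < p)
    {π : Measure ((∀ i, X i) × (∀ i, X i))} [IsProbabilityMeasure π]
    (hπ : IsBicausalCoupling π μ ν) :
    adaptedWasserstein d p μ ν ^ p ≤ ∫⁻ z, ENNReal.ofReal (d z.1 z.2) ^ p ∂π := by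
  have h1 : adaptedWasserstein d p μ ν ≤
      (∫⁻ z, ENNReal.ofReal (d z.1 z.2) ^ p ∂π) ^ (1 / p) :=
    iInf₂_le (⟨π, inferInstance⟩ : ProbabilityMeasure _) hπ
  refine (ENNReal.rpow_le_rpow h1 hp.le).trans (le_of_eq ?_)
  rw [← ENNReal.rpow_mul, one_div_mul_cancel hp.ne', ENNReal.rpow_one]

variable [IsProbabilityMeasure μ] [IsProbabilityMeasure ν]

theorem isBicausalCoupling_separationCoupling {M : ℕ → (∀ i, X i) → ℝ≥0}
    (h : IsDensityProcess μ (pathFiltration X) T M)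
    (hν : μ.withDensity (fun z => (M T z : ℝ≥0∞)) = ν)
    [IsProbabilityMeasure (separationCoupling μ (pathFiltration X) T M)] :
    IsBicausalCoupling (separationCoupling μ (pathFiltration X) T M) μ ν where
  map_fst := h.map_fst_separationCoupling
  map_snd := h.map_snd_separationCoupling.trans hν
  causal t _ ht := condIndepFun_of_lintegral_eq (ρ := μ) measurable_fst measurable_snd
    (measurable_pathUpTo t) (measurable_pathUpTo_fst t).comap_le fun _ _ _ hf hf' hg hff =>
      h.lintegral_separationCoupling_fst ht.le hf hf' hg hff
  anticausal t _ ht := condIndepFun_of_lintegral_eq (ρ := ν) measurable_snd measurable_fst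
    (measurable_pathUpTo t) (measurable_pathUpTo_snd t).comap_le fun _ _ _ hf hf' hg hff =>
      h.lintegral_separationCoupling_snd ht.le hf hf' hg (by rw [hν]; exact hff)

theorem adaptedWasserstein_rpow_le_klDiv {d : (∀ i, X i) → (∀ i, X i) → ℝ}
    (hd : Measurable fun z : (∀ i, X i) × (∀ i, X i) => d z.1 z.2)
    (hself : ∀ x, d x x = 0) (hcomm : ∀ x y, d x y = d y x)
    (htri : ∀ x y z, d x z ≤ d x y + d y z) (hnonneg : ∀ x y, 0 ≤ d x y)
    {p : ℝ} (hp : 1 < p) (x₀ : ∀ i, X i) {α : ℝ} (hα : 0 < α)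
    (hμ : Integrable (fun x => Real.exp (α * d x x₀ ^ (2 * p))) μ) :
    adaptedWasserstein d p μ ν ^ p ≤
      ENNReal.ofReal
        (2 ^ (p - 1) * (2 * √(T : ℝ) + 1) / √α *
          (1 + Real.log (∫ x, Real.exp (α * d x x₀ ^ (2 * p)) ∂μ)) ^ (1 / 2 : ℝ)) *
        (2 * klDiv ν μ) ^ (1 / 2 : ℝ) := by
  have hI : 1 ≤ ∫ x, Real.exp (α * d x x₀ ^ (2 * p)) ∂μ := by
    calc (1 : ℝ) = ∫ _, 1 ∂μ := by simp
      _ ≤ _ := integral_mono (integrable_const 1) hμ fun x => Real.one_le_exp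
        (mul_nonneg hα.le (Real.rpow_nonneg (hnonneg _ _) _))
  set I := ∫ x, Real.exp (α * d x x₀ ^ (2 * p)) ∂μ with hIdef
  have hlog : 0 ≤ Real.log I := Real.log_nonneg hI
  by_cases hac : ν ≪ μ
  swap
  -- The constant in front is strictly positive, so the right side is `∞`.
  · rw [klDiv_of_not_ac hac, ENNReal.mul_top two_ne_zero,
      ENNReal.top_rpow_of_pos (by norm_num), ENNReal.mul_top]
    · exact le_top
    · exact (ENNReal.ofReal_pos.2 (by positivity)).ne'
  have h := isDensityProcess_rnDerivProcess (T := T) hac pathFiltration_zero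
  have hν := withDensity_rnDerivProcess hac (pathFiltration_last (X := X))
  have hH := densityEntropy_rnDerivProcess hac (pathFiltration_last (X := X))
  have hM := (lintegral_congr_ae
    (rnDerivProcess_last_ae_eq hac (pathFiltration_last (X := X)))).trans
      (lintegral_rnDeriv_eq_one hac)
  set M := rnDerivProcess μ ν (pathFiltration X)
  have hprob : IsProbabilityMeasure (separationCoupling μ (pathFiltration X) T M) := by
    constructor
    rw [← Set.preimage_univ (f := Prod.fst), ← Measure.map_apply measurable_fst MeasurableSet.univ,
      h.map_fst_separationCoupling, measure_univ]
  refine (adaptedWasserstein_rpow_le (by linarith)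
    (isBicausalCoupling_separationCoupling h hν)).trans ?_
  have hdx : Measurable fun x => d x x₀ := hd.comp (measurable_id.prodMk measurable_const)
  set φ : (∀ i, X i) → ℝ≥0 := fun x => (d x x₀).toNNReal ^ p with hφ
  have hφm : Measurable φ := hdx.real_toNNReal.pow_const p
  have hφr : ∀ x, ((α.toNNReal * φ x ^ 2 : ℝ≥0) : ℝ) = α * d x x₀ ^ (2 * p) := fun x => by
    push_cast [hφ]
    rw [Real.coe_toNNReal _ hα.le, Real.coe_toNNReal _ (hnonneg _ _), mul_comm 2 p,
      Real.rpow_mul (hnonneg _ _), Real.rpow_two]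
  have hφe : ∀ x, (φ x : ℝ≥0∞) = ENNReal.ofReal (d x x₀) ^ p := fun x => by
    rw [hφ, ENNReal.ofReal, ENNReal.coe_rpow_of_nonneg _ (by linarith)]
  have hcost := h.lintegral_cost_le (Φ := fun z => ENNReal.ofReal (d z.1 z.2) ^ p)
    (φ := fun x => (φ x : ℝ≥0∞)) (C := 2 ^ (p - 1)) (hd.ennreal_ofReal.pow_const p)
    hφm.coe_nnreal_ennreal
    (fun x => by simp [hself, ENNReal.zero_rpow_of_pos (zero_lt_one.trans hp)]) (fun a => by
      rw [hφe, hφe]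
      refine le_trans ?_ (ENNReal.rpow_add_le_mul_rpow_add_rpow _ _ hp.le)
      rw [← ENNReal.ofReal_add (hnonneg _ _) (hnonneg _ _)]
      gcongr
      rw [hcomm a.2 x₀]
      exact htri _ _ _)
  -- With `L = log I` the normalised exponential integrates to exactly `1`.
  have hweight := h.lintegral_weight_le hφm (a := α.toNNReal) (L := (Real.log I).toNNReal)
    (by simpa using hα) (by
      simp only [hφr, Real.coe_toNNReal _ hlog, Real.exp_sub, Real.exp_log (zero_lt_one.trans_le hI)]
      rw [← ofReal_integral_eq_lintegral_ofReal (hμ.div_const _)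
        (Filter.Eventually.of_forall fun x => by positivity), integral_div, ← hIdef,
        div_self (zero_lt_one.trans_le hI).ne', ENNReal.ofReal_one]) hM
  rw [hH, Real.coe_toNNReal _ hlog, Real.coe_toNNReal _ hα.le] at hweight
  refine hcost.trans ((mul_le_mul_right hweight _).trans (le_of_eq ?_))
  have e2 : (2 : ℝ≥0∞) ^ (p - 1) = ENNReal.ofReal (2 ^ (p - 1)) := by
    rw [← ENNReal.ofReal_rpow_of_pos zero_lt_two, ENNReal.ofReal_ofNat]
  rw [← mul_assoc, e2, ← ENNReal.ofReal_mul (by positivity)]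
  congr 2
  ring

end Path

theorem corollary1p6 {T : ℕ} {X : Fin T → Type*}
    [∀ i, TopologicalSpace (X i)] [∀ i, PolishSpace (X i)]
    [∀ i, MeasurableSpace (X i)] [∀ i, BorelSpace (X i)]
    -- `m` is any metric on the product that metrizes the product topology
    (m : MetricSpace (∀ i, X i))
    (hm : m.toUniformSpace.toTopologicalSpace = Pi.topologicalSpace)
    (p : ℝ) (hp : 1 < p)
    (μ : Measure (∀ i, X i)) [IsProbabilityMeasure μ]
    (x₀ : ∀ i, X i) (α : ℝ) (hα : 0 < α)
    (hμ : Integrable (fun x => Real.exp (α * m.dist x x₀ ^ (2 * p))) μ)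
    (ν : Measure (∀ i, X i)) [IsProbabilityMeasure ν] :
    adaptedWasserstein m.dist p μ ν ^ p ≤
      ENNReal.ofReal
        (2 ^ (p - 1) * (2 * √(T : ℝ) + 1) / √α *
          (1 + Real.log (∫ x, Real.exp (α * m.dist x x₀ ^ (2 * p)) ∂μ)) ^ (1 / 2 : ℝ)) *
        (2 * klDiv ν μ) ^ (1 / 2 : ℝ) := by
  -- The σ-algebra is Borel for the product topology, so continuity of the metric must be moved
  -- there through `hm`.
  have hc : @Continuous ((∀ i, X i) × (∀ i, X i)) ℝ
      (@instTopologicalSpaceProd _ _ Pi.topologicalSpace Pi.topologicalSpace) _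
      (fun z => m.dist z.1 z.2) := by
    rw [← hm]
    exact @continuous_dist _ m.toPseudoMetricSpace
  have hd : Measurable fun z : (∀ i, X i) × (∀ i, X i) => m.dist z.1 z.2 :=
    @Continuous.measurable _ _ (@instTopologicalSpaceProd _ _ Pi.topologicalSpace
      Pi.topologicalSpace) _ (@Prod.opensMeasurableSpace _ _ Pi.topologicalSpace _ _
        Pi.topologicalSpace _ _ _) _ _ _ _ hc
  exact adaptedWasserstein_rpow_le_klDiv hd m.dist_self m.dist_comm m.dist_triangle
    (fun x y => @dist_nonneg _ m.toPseudoMetricSpace x y) hp x₀ hα hμ
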